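/- All schemes are separated and noetherian. For a scheme $X$ and $p\in\mathbb Z$ let $X^{(p)}$ be the set of points of $X$ whose closure has codimension $p$ in $X$ (empty if $p<0$). For a closed subset $Y\subseteq X$ let $\mathcal Z^p_Y(X)$ be the free abelian group on the classes $[V]$ of the closures $V$ of the points $v\in X^{(p)}\cap Y$, and let $$\mathrm{CH}^p_Y(X)=\operatorname{coker}\Bigl(\bigoplus_{w\in X^{(p-1)}\cap Y}\kappa(w)^\times\xrightarrow{\ \mathrm{div}\ }\mathcal Z^p_Y(X)\Bigr),\qquad \mathrm{div}(f)=\sum_{v\in X^{(p)}\cap W}\nu_v(f)[V]\quad (W=\overline{\{w\}}),$$ where $\nu_v:\kappa(w)^\times\to\mathbb Z$ is the homomorphism with $\nu_v(a)=\mathrm{length}(\mathcal O_{W,v}/(a))$ for $0\ne a\in\mathcal O_{W,v}$. The space $X$ is unicodimensional if $\mathrm{codim}_X(V)=\mathrm{codim}_{X_i}(V)$ for every irreducible component $X_i$ and every irreducible closed $V\subseteq X_i$. Let $\overline\square^1=\operatorname{Proj}\mathbb Z[T_0,T_1]$, $t=T_0/T_1$, $\square^1=\overline\square^1\setminus\{t=\infty\}$,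 and let $\iota_q:X\hookrightarrow X\times\square^1$ be the section $t=q$. Let $D$ be an effective Cartier divisor on $X$. A closed subset $W\subseteq X\times\square^1$ satisfies the modulus condition along $D$ if on the normalization $\phi:\overline W^N\to\overline W$ of its closure in $X\times\overline\square^1$ (with the reduced structure) one has $\phi^*(D\times\overline\square^1)\le\phi^*(X\times\{\infty\})$ as Cartier divisors (in particular no component of $W$ lies in $D\times\square^1$). Let $\mathcal S(X|D)$ be the set of closed subsets of $X$ not meeting $D$, and $\mathcal S(X|D,1)$ the set of closed subsets of $X\times\square^1$ satisfying the modulus condition along $D$; both are ordered by inclusion. Let $\mathcal Z^p(X|D)$ be the free abelian group on the $[V]$ for $v\in X^{(p)}$ with $V=\overline{\{v\}}$ not meeting $D$, and $\mathcal Z^p(X|D,1)$ the free abelian group on the $[W]$ for $w\in(X\times\square^1)^{(p)}$ such that $W=\overline{\{w\}}$ is contained neither in $X\times\{0\}$ nor in $X\times\{1\}$ and satisfies the modulus condition along $D$. For $v\in(X\times\square^1)^{(p)}$ with closure $V$, and $q\in\{0,1\}$: if $V\not\subseteq X\times\{q\}$, then $\iota_q^*[V]$ is the cycle $\sum_x\mathrm{length}(\mathcal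 O_{V\times_{X\times\square^1}X,\,x})\,[\overline{\{x\}}]$ of the fibre of $V$ over $t=q$, where $x$ runs over those generic points of that fibre that lie in $X^{(p)}$ (this means all its generic points when $X\times\square^1$ is unicodimensional and catenary); if $V\subseteq X\times\{q\}$, then $\iota_q^*[V]$ is the push-forward to $X$ of the class in $\mathrm{CH}^1(V)$ of the line bundle $\mathcal O(X\times\{q\})|_V$. Put $$\mathrm{CH}^p(X|D)=\operatorname{coker}\bigl(\mathcal Z^p(X|D,1)\xrightarrow{\iota_0^*-\iota_1^*}\mathcal Z^p(X|D)\bigr).$$ **Proposition.** Let $X$ be a unicodimensional catenary scheme, $D$ an effective Cartier divisor on $X$ and $p$ an integer. Then the canonical maps $\mathcal Z^p_Y(X)\to\mathrm{CH}^p(X|D)$, $Y\in\mathcal S(X|D)$, induce a homomorphism $\epsilon$ on $\operatorname{colim}_{Y\in\mathcal S(X|D)}\mathrm{CH}^p_Y(X)$, and the sequence $$\operatorname*{colim}_{Y\in\mathcal S(X|D,1)}\mathcal Z^p_Y(X\times\square^1)\xrightarrow{\ \iota_0^*-\iota_1^*\ }\operatorname*{colim}_{Y\in\mathcal S(X|D)}\mathrm{CH}^p_Y(X)\xrightarrow{\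 \epsilon\ }\mathrm{CH}^p(X|D)\to0$$ is exact. -/

import Mathlib

universe u

open CategoryTheory CategoryTheory.Limits AlgebraicGeometry TopologicalSpace

namespace ChowMod

noncomputable section

/-! ### Codimension, unicodimensional and catenary spaces -/

/-- The codimension of `V` in `W`, for irreducible closed subsets `V ⊆ W` of `T`: the supremum of
the lengths of chains `V = V₀ ⊊ V₁ ⊊ ⋯ ⊊ Vₙ ⊆ W` of irreducible closed subsets. -/
def codimIn {T : Type*} [TopologicalSpace T] (V W : IrreducibleCloseds T) (h : V ≤ W) : ℕ∞ :=
  Order.coheight (⟨V, h⟩ : Set.Iic W)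

/-- `T` is unicodimensional: `codim_T V = codim_W V` for every irreducible component `W` and every
irreducible closed `V ⊆ W`. -/
def IsUnicodimensional (T : Type*) [TopologicalSpace T] : Prop :=
  ∀ W : IrreducibleCloseds T, (W : Set T) ∈ irreducibleComponents T →
    ∀ (V : IrreducibleCloseds T) (h : V ≤ W), Order.coheight V = codimIn V W h

/-- `T` is catenary: for irreducible closed subsets `V ⊆ W`, all maximal chains of irreducible
closed subsets between `V` and `W` have the same finite length. -/
def IsCatenary (T : Type*) [TopologicalSpace T] : Prop :=
  ∀ V W : IrreducibleCloseds T, V ≤ W →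
    ∃ n : ℕ, ∀ c : Flag (Set.Icc V W), (c : Set (Set.Icc V W)).encard = n

/-- `X^(p)`, the set of points of codimension `p`. The preorder of a scheme is the specialization
order with generic points on top, so `Order.coheight v` is the codimension of the closure of `v`. -/
def pointsOfCodim (X : Scheme.{u}) (p : ℤ) : Set X :=
  {v | ∃ n : ℕ, (n : ℤ) = p ∧ Order.coheight v = n}

/-- `x` is the generic point of an irreducible component of the closed set `S`. -/
def IsGenericIn {X : Scheme.{u}} (S : Set X) (x : X) : Prop :=
  x ∈ S ∧ ∀ y ∈ S, y ⤳ x → y = x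

/-! ### Cycles -/

/-- The free abelian group on the points of `X^(p)` lying in the set of points `S`. -/
abbrev Cycles (X : Scheme.{u}) (p : ℤ) (S : Set X) : Type u :=
  {v : X // v ∈ pointsOfCodim X p ∧ v ∈ S} →₀ ℤ

/-- The inclusion of groups of cycles for `S ⊆ S'`. -/
def Cycles.incl {X : Scheme.{u}} (p : ℤ) {S S' : Set X} (h : S ⊆ S') :
    Cycles X p S →+ Cycles X p S' :=
  Finsupp.mapDomain.addMonoidHom fun v => ⟨v.1, v.2.1, h v.2.2⟩

lemma Cycles.incl_single {X : Scheme.{u}} (p : ℤ) {S S' : Set X} (h : S ⊆ S')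
    (v : {v : X // v ∈ pointsOfCodim X p ∧ v ∈ S}) (n : ℤ) :
    Cycles.incl p h (Finsupp.single v n) = Finsupp.single ⟨v.1, v.2.1, h v.2.2⟩ n :=
  Finsupp.mapDomain_single

lemma Cycles.incl_apply {X : Scheme.{u}} (p : ℤ) {S S' : Set X} (h : S ⊆ S')
    (z : Cycles X p S) (v : {v : X // v ∈ pointsOfCodim X p ∧ v ∈ S'}) (hv : v.1 ∈ S) :
    Cycles.incl p h z v = z ⟨v.1, v.2.1, hv⟩ :=
  Finsupp.mapDomain_apply (f := fun v : {v : X // v ∈ pointsOfCodim X p ∧ v ∈ S} =>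
      (⟨v.1, v.2.1, h v.2.2⟩ : {v : X // v ∈ pointsOfCodim X p ∧ v ∈ S'}))
    (fun _ _ hab => Subtype.ext (Subtype.mk.inj hab)) z ⟨v.1, v.2.1, hv⟩

lemma Cycles.incl_apply_of_notMem {X : Scheme.{u}} (p : ℤ) {S S' : Set X} (h : S ⊆ S')
    (z : Cycles X p S) (v : {v : X // v ∈ pointsOfCodim X p ∧ v ∈ S'}) (hv : v.1 ∉ S) :
    Cycles.incl p h z v = 0 := by
  refine Finsupp.mapDomain_of_notMem_range _ _ ?_
  rintro ⟨w, rfl⟩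
  exact hv w.2.2

lemma Cycles.incl_incl {X : Scheme.{u}} (p : ℤ) {S S' S'' : Set X} (h : S ⊆ S') (h' : S' ⊆ S'')
    (z : Cycles X p S) : Cycles.incl p h' (Cycles.incl p h z) = Cycles.incl p (h.trans h') z := by
  induction z using Finsupp.induction_linear with
  | zero => simp
  | add f g hf hg => simp only [map_add, hf, hg]
  | single v n => simp only [Cycles.incl_single]

/-! ### Divisors of rational functions and Chow groups with supports -/

/-- The ideal in `𝒪_{X,x}` of the closure `W` of `w`, for `x ∈ W`. -/
def primeOf {X : Scheme.{u}} {w x : X} (h : w ⤳ x) : Ideal (X.presheaf.stalk x) :=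
  (IsLocalRing.maximalIdeal (X.presheaf.stalk w)).comap (X.presheaf.stalkSpecializes h).hom

/-- The local ring `𝒪_{W,x} = 𝒪_{X,x} ⧸ primeOf h` at `x` of the closure `W` of `w`, where `W`
carries the reduced structure. -/
abbrev LocalRingAt {X : Scheme.{u}} {w x : X} (h : w ⤳ x) : Type u :=
  X.presheaf.stalk x ⧸ primeOf h

/-- The inclusion of `𝒪_{W,x}` into its field of fractions `κ(w)`. -/
def toResidueField {X : Scheme.{u}} {w x : X} (h : w ⤳ x) :
    LocalRingAt h →+* X.residueField w :=
  Ideal.Quotient.lift (primeOf h)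
    ((X.residue w).hom.comp (X.presheaf.stalkSpecializes h).hom) fun a ha => by
      exact (IsLocalRing.residue_eq_zero_iff _).2 ha

/-- `ν_x(f) = n`, where `ν_x : κ(w)ˣ → ℤ` is the homomorphism sending a nonzero `a ∈ 𝒪_{W,x}` to
the length of `𝒪_{W,x} ⧸ (a)` (a finite length when `𝒪_{W,x}` has dimension at most one). -/
def IsOrd {X : Scheme.{u}} {w x : X} (h : w ⤳ x) (f : X.residueField w) (n : ℤ) : Prop :=
  ∃ a b : LocalRingAt h, a ≠ 0 ∧ b ≠ 0 ∧ f * toResidueField h b = toResidueField h a ∧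
    n = ((Ring.ord (LocalRingAt h) a).toNat : ℤ) - (Ring.ord (LocalRingAt h) b).toNat

/-- The cycle `z` is the divisor of the rational function `f` on the closure of `w`. -/
def IsDiv {X : Scheme.{u}} {p : ℤ} {S : Set X} (w : X) (f : (X.residueField w)ˣ)
    (z : Cycles X p S) : Prop :=
  ∀ v : {v : X // v ∈ pointsOfCodim X p ∧ v ∈ S},
    (∀ h : w ⤳ v.1, IsOrd h (f : X.residueField w) (z v)) ∧ (¬ w ⤳ v.1 → z v = 0)

/-- The subgroup of `Z^p_Y(X)` generated by the divisors `div f`, `f ∈ κ(w)ˣ`,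
`w ∈ X^(p-1) ∩ Y`. -/
def principalCycles (X : Scheme.{u}) (p : ℤ) (Y : Closeds X) : AddSubgroup (Cycles X p Y) :=
  AddSubgroup.closure {z | ∃ w ∈ pointsOfCodim X (p - 1), w ∈ Y ∧
    ∃ f : (X.residueField w)ˣ, IsDiv w f z}

/-- The Chow group `CH^p_Y(X)` with supports in the closed subset `Y`. -/
abbrev Chow (X : Scheme.{u}) (p : ℤ) (Y : Closeds X) : Type u :=
  Cycles X p Y ⧸ principalCycles X p Y

/-- The class of a cycle in the Chow group with supports. -/
def Chow.mk {X : Scheme.{u}} {p : ℤ} {Y : Closeds X} : Cycles X p Y →+ Chow X p Y :=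
  QuotientAddGroup.mk' (principalCycles X p Y)

/-- The canonical map `CH^p_Y(X) → CH^p_{Y'}(X)` for `Y ⊆ Y'`. -/
def Chow.map {X : Scheme.{u}} (p : ℤ) {Y Y' : Closeds X} (h : Y ≤ Y') :
    Chow X p Y →+ Chow X p Y' :=
  QuotientAddGroup.map _ _ (Cycles.incl p (show (Y : Set X) ⊆ Y' from h)) <| by
    rw [principalCycles, AddSubgroup.closure_le]
    rintro z ⟨w, hw, hwY, f, hf⟩
    refine AddSubgroup.subset_closure ⟨w, hw, h hwY, f, fun v => ?_⟩
    by_cases hv : v.1 ∈ (Y : Set X)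
    · rw [Cycles.incl_apply p _ z v hv]
      exact hf ⟨v.1, v.2.1, hv⟩
    · rw [Cycles.incl_apply_of_notMem p _ z v hv]
      exact ⟨fun hs => absurd (hs.mem_closed Y.isClosed hwY) hv, fun _ => rfl⟩

lemma Chow.map_mk {X : Scheme.{u}} (p : ℤ) {Y Y' : Closeds X} (h : Y ≤ Y') (z : Cycles X p Y) :
    Chow.map p h (Chow.mk z) = Chow.mk (Cycles.incl p (show (Y : Set X) ⊆ Y' from h) z) :=
  rfl

lemma Chow.map_map {X : Scheme.{u}} (p : ℤ) {Y Y' Y'' : Closeds X} (h : Y ≤ Y') (h' : Y' ≤ Y'')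
    (z : Chow X p Y) : Chow.map p h' (Chow.map p h z) = Chow.map p (h.trans h') z := by
  obtain ⟨z, rfl⟩ := QuotientAddGroup.mk'_surjective _ z
  exact congrArg Chow.mk (Cycles.incl_incl p _ _ z)

/-! ### Pull-back of cycles to a divisor -/

/-- In a noetherian scheme a closed set has finitely many generic points. -/
lemma finite_isGenericIn {X : Scheme.{u}} [IsNoetherian X] {S : Set X} (hS : IsClosed S) :
    {x : X | IsGenericIn S x}.Finite := by
  obtain ⟨C, hC, hcl, hirr, hSC⟩ :=
    NoetherianSpace.exists_finite_set_isClosed_irreducible hS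
  refine Set.Finite.of_finite_image (f := fun x : X => closure {x}) (hC.subset ?_) ?_
  · rintro _ ⟨x, hx, rfl⟩
    have hx' := hx.1
    rw [hSC] at hx'
    obtain ⟨t, ht, hxt⟩ := hx'
    obtain ⟨g, hg⟩ := QuasiSober.sober (hirr t ht) (hcl t ht)
    have hgt : g ∈ t := hg.def ▸ subset_closure (Set.mem_singleton g)
    have hgS : g ∈ S := hSC ▸ ⟨t, ht, hgt⟩
    have := hx.2 g hgS (hg.specializes hxt)
    subst this
    have h2 : closure {g} = t := hg.def
    rw [← h2] at ht
    exact ht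
  · intro x _ y _ hxy
    exact IsGenericPoint.eq (S := closure {x}) rfl hxy.symm

/-- In a closed subset of a scheme every point specializes from a generic point. -/
lemma exists_isGenericIn {X : Scheme.{u}} {S : Set X} (hS : IsClosed S) {x : X} (hx : x ∈ S) :
    ∃ g, IsGenericIn S g ∧ g ⤳ x := by
  have := hS.isClosedEmbedding_subtypeVal.quasiSober
  obtain ⟨g, hg⟩ := QuasiSober.sober
    (isIrreducible_irreducibleComponent (x := (⟨x, hx⟩ : S))) isClosed_irreducibleComponent
  refine ⟨g.1, ⟨g.2, fun y hy hyg => ?_⟩, ?_⟩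
  · have h1 : irreducibleComponent (⟨x, hx⟩ : S) ⊆ closure {⟨y, hy⟩} := by
      rw [← hg.def]
      exact (Topology.IsInducing.subtypeVal.specializes_iff.1 hyg).closure_subset
    have h2 := eq_irreducibleComponent isIrreducible_singleton.closure.isPreirreducible h1
    have h3 : (⟨y, hy⟩ : S) = g := IsGenericPoint.eq (S := irreducibleComponent ⟨x, hx⟩) h2 hg
    exact congrArg Subtype.val h3
  · exact (hg.specializes mem_irreducibleComponent).map continuous_subtype_val

/-- The preimage in `D` of the closure of the point `v` of `P`. -/
def preClosure {D P : Scheme.{u}} (i : D ⟶ P) (v : P) : Closeds D :=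
  (Closeds.closure {v}).preimage i.continuous

open Classical in
/-- The cycle `[V ×_P D]` for a closed immersion `i : D ⟶ P`, where `V` is the closure of `v`, with
its reduced structure, and `V` is not contained in `D`. The coefficient at a generic point `x` of
`V ×_P D` is the length of its local ring `𝒪_{P,x} ⧸ (I_V + I_D)`. Only the generic points in
`D^(p)` contribute; when `P` is unicodimensional and catenary, `i` is an effective Cartier divisor
and `v ∈ P^(p)`, these are all of them. -/
def intersectionCycle {D P : Scheme.{u}} [IsNoetherian D] (i : D ⟶ P) (p : ℤ) (v : P) :
    Cycles D p (preClosure i v) :=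
  Finsupp.ofSupportFinite
    (fun x =>
      if h : IsGenericIn (preClosure i v : Set D) x.1 then
        ((Module.length (P.presheaf.stalk (i x.1))
          (P.presheaf.stalk (i x.1) ⧸
            (primeOf (specializes_iff_mem_closure.2 h.1) ⊔
              RingHom.ker (i.stalkMap x.1).hom))).toNat : ℤ)
      else 0) <| by
    refine Set.Finite.of_finite_image (f := Subtype.val)
      ((finite_isGenericIn (preClosure i v).isClosed).subset ?_) Subtype.val_injective.injOn
    rintro _ ⟨x, hx, rfl⟩
    by_contra hcon
    exact hx (dif_neg hcon)

/-- For an effective Cartier divisor `i : D ⟶ P` and an integral closed subscheme `V` of `D`, with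
generic point `v`, the cycle `z` is the push-forward to `D` of the divisor on `V` of a nonzero
rational section of the line bundle `𝒪_P(D)|_V`. The section is `g⁻¹`, for a local equation `g` of
`D` at `v`. If `g'` is a local equation of `D` at `x ∈ V` and `g' = u g` in `𝒪_{P,v}`, then `g'⁻¹`
generates `𝒪_P(D)` at `x`, so the order of the section at `x` is `ν_x` of the residue class of
`u`. -/
def IsDivOfNormalBundle {D P : Scheme.{u}} (i : D ⟶ P) (p : ℤ) (v : P)
    (z : Cycles D p (preClosure i v)) : Prop :=
  ∃ w : D, i w = v ∧ ∃ g : P.presheaf.stalk (i w),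
    Ideal.span {g} = RingHom.ker (i.stalkMap w).hom ∧
    ∀ x : {x : D // x ∈ pointsOfCodim D p ∧ x ∈ (preClosure i v : Set D)},
      ∃ (h : i w ⤳ i x.1) (g' : P.presheaf.stalk (i x.1)) (u : P.presheaf.stalk (i w)),
        Ideal.span {g'} = RingHom.ker (i.stalkMap x.1).hom ∧
        P.presheaf.stalkSpecializes h g' = u * g ∧
        IsOrd h (P.residue (i w) u) (z x)

open Classical in
/-- The class `i^*[V]` of the closure `V` of `v`, with supports in `V ∩ D`: it is `[V ×_P D]` if `V`
is not contained in `D`, and the push-forward of the class `[𝒪_P(D)|_V] ∈ CH¹(V)` if it is. This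
class does not depend on the chosen rational section. -/
def pullbackClass {D P : Scheme.{u}} [IsNoetherian D] (i : D ⟶ P) (p : ℤ) (v : P) :
    Chow D p (preClosure i v) :=
  if v ∈ Set.range i then
    if h : ∃ z, IsDivOfNormalBundle i p v z then Chow.mk h.choose else 0
  else Chow.mk (intersectionCycle i p v)

lemma preClosure_le {D P : Scheme.{u}} (i : D ⟶ P) {v : P} {Y : Closeds P} (hv : v ∈ Y) :
    preClosure i v ≤ Y.preimage i.continuous := fun _ hx =>
  (closure_minimal (Set.singleton_subset_iff.2 hv) Y.isClosed) hx

/-- The pull-back `i^* : Z^p_Y(P) → CH^p_{Y ∩ D}(D)`. -/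
def pullbackHom {D P : Scheme.{u}} [IsNoetherian D] (i : D ⟶ P) (p : ℤ) (Y : Closeds P) :
    Cycles P p Y →+ Chow D p (Y.preimage i.continuous) :=
  Finsupp.liftAddHom fun v => zmultiplesHom (Chow D p (Y.preimage i.continuous))
    (Chow.map p (preClosure_le i v.2.2) (pullbackClass i p v.1))

lemma pullbackHom_incl {D P : Scheme.{u}} [IsNoetherian D] (i : D ⟶ P) (p : ℤ) {Y Y' : Closeds P}
    (h : Y ≤ Y') (z : Cycles P p Y) :
    pullbackHom i p Y' (Cycles.incl p (show (Y : Set P) ⊆ Y' from h) z) =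
      Chow.map p (show Y.preimage i.continuous ≤ Y'.preimage i.continuous from fun _ hx => h hx)
        (pullbackHom i p Y z) := by
  induction z using Finsupp.induction_linear with
  | zero => simp
  | add f g hf hg => simp only [map_add, hf, hg]
  | single v n =>
    rw [Cycles.incl_single]
    simp [pullbackHom, Chow.map_map]

/-! ### The interval and the modulus condition -/

/-- `X × □¹`, the affine line over `X`. -/
abbrev Box (X : Scheme.{u}) : Scheme.{u} := AffineSpace PUnit.{u + 1} X

/-- The projection `X × □¹ ⟶ X`. -/
abbrev Box.proj (X : Scheme.{u}) : Box X ⟶ X := Box X ↘ X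

/-- The coordinate `t` on `X × □¹`. -/
abbrev Box.t (X : Scheme.{u}) : Γ(Box X, ⊤) := AffineSpace.coord X PUnit.unit

/-- The section `ι_q : X ⟶ X × □¹` given by `t = q`. -/
def iota (X : Scheme.{u}) (q : ℤ) : X ⟶ Box X :=
  AffineSpace.homOfVector (𝟙 X) fun _ => (q : Γ(X, ⊤))

/-- The standard grading of `ℤ[T₀, T₁]`. -/
abbrev grading : ℕ → Submodule (ULift.{u} ℤ) (MvPolynomial (Fin 2) (ULift.{u} ℤ)) :=
  MvPolynomial.homogeneousSubmodule (Fin 2) (ULift.{u} ℤ)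

instance : GradedAlgebra grading.{u} := MvPolynomial.gradedAlgebra

/-- The projective line `Proj ℤ[T₀, T₁]`. -/
abbrev P1 : Scheme.{u} := Proj grading.{u}

/-- The evaluation `ℤ[T₀, T₁] → Γ(Y, 𝒪_Y)` with `T₀ ↦ a`, `T₁ ↦ b`. -/
def evalHom {Y : Scheme.{u}} (a b : Γ(Y, ⊤)) :
    MvPolynomial (Fin 2) (ULift.{u} ℤ) →+* Γ(Y, ⊤) :=
  MvPolynomial.eval₂Hom ((Int.castRingHom Γ(Y, ⊤)).comp ULift.ringEquiv.toRingHom) ![a, b]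

/-- The morphism `[a : b] : Y ⟶ ℙ¹` for global functions `a`, `b` one of which is a unit. -/
def homogeneousPoint {Y : Scheme.{u}} (a b : Γ(Y, ⊤)) (h : IsUnit a ∨ IsUnit b) : Y ⟶ P1.{u} :=
  Proj.fromOfGlobalSections grading (evalHom a b) <| by
    have hX (j : Fin 2) : (MvPolynomial.X j : MvPolynomial (Fin 2) (ULift.{u} ℤ)) ∈
        (HomogeneousIdeal.irrelevant grading.{u}).toIdeal :=
      HomogeneousIdeal.mem_irrelevant_of_mem _ one_pos (MvPolynomial.isHomogeneous_X _ j)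
    rcases h with h | h
    · exact Ideal.eq_top_of_isUnit_mem _ (by simpa [evalHom] using Ideal.mem_map_of_mem (evalHom a b) (hX 0)) h
    · exact Ideal.eq_top_of_isUnit_mem _ (by simpa [evalHom] using Ideal.mem_map_of_mem (evalHom a b) (hX 1)) h

/-- `X × ℙ¹`, the compactification of `X × □¹`. -/
abbrev BoxBar (X : Scheme.{u}) : Scheme.{u} :=
  pullback (terminal.from X) (terminal.from P1.{u})

/-- The open immersion `X × □¹ ⟶ X × ℙ¹`, `(x, t) ↦ (x, [t : 1])`. -/
def toBoxBar (X : Scheme.{u}) : Box X ⟶ BoxBar X :=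
  pullback.lift (Box.proj X) (homogeneousPoint (Box.t X) 1 (Or.inr isUnit_one))
    (terminal.hom_ext _ _)

/-- The section `X ⟶ X × ℙ¹` at `t = ∞`, that is, `x ↦ (x, [1 : 0])`. -/
def infinity (X : Scheme.{u}) : X ⟶ BoxBar X :=
  pullback.lift (𝟙 X) (homogeneousPoint 1 0 (Or.inl isUnit_one)) (terminal.hom_ext _ _)

/-- The ideal sheaf `I` defines an effective Cartier divisor: locally it is generated by a
nonzerodivisor. -/
def IsEffectiveCartier {X : Scheme.{u}} (I : X.IdealSheafData) : Prop :=
  ∀ x : X, ∃ U : X.affineOpens, x ∈ U.1 ∧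
    ∃ f ∈ nonZeroDivisors Γ(X, U.1), I.ideal U = Ideal.span {f}

/-- The structure morphism to `Z` of the normalization of the closure of `η` in `Z`, with its
reduced structure: the normalization of `Z` in `Spec κ(η)`. -/
abbrev normalizationMap (Z : Scheme.{u}) (η : Z) : (Z.fromSpecResidueField η).normalization ⟶ Z :=
  (Z.fromSpecResidueField η).fromNormalization

/-- The closed subset `W` of `X × □¹` satisfies the modulus condition along `D`. The normalization
of the closure of `W` in `X × ℙ¹` is the disjoint union of the normalizations of its irreducible
components, and on each of them the pull-backs of Cartier divisors have to satisfy
`φ^*(D × ℙ¹) ≤ φ^*(X × ∞)`. For the ideal sheaves this is the reverse inclusion; it fails if a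
component lies in `D × ℙ¹`. -/
def SatisfiesModulus {X : Scheme.{u}} (D : X.IdealSheafData) (W : Set (Box X)) : Prop :=
  ∀ η : Box X, IsGenericIn W η →
    (infinity X).ker.comap (normalizationMap (BoxBar X) (toBoxBar X η)) ≤
      (D.comap (pullback.fst (terminal.from X) (terminal.from P1.{u}))).comap
        (normalizationMap (BoxBar X) (toBoxBar X η))

lemma preimage_basicOpen_homogeneousPoint {Y : Scheme.{u}} (a b : Γ(Y, ⊤))
    (h : IsUnit a ∨ IsUnit b) :
    homogeneousPoint a b h ⁻¹ᵁ Proj.basicOpen grading (MvPolynomial.X 1) = Y.basicOpen b := by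
  rw [homogeneousPoint, Proj.fromOfGlobalSections_preimage_basicOpen grading _ _ one_pos
    (MvPolynomial.isHomogeneous_X _ 1)]
  simp [evalHom]

/-- The closed subset `X × ∞` does not meet `X × □¹`. -/
lemma toBoxBar_notMem_support {X : Scheme.{u}} [IsNoetherian X] (y : Box X) :
    toBoxBar X y ∉ (infinity X).ker.support := by
  set U : (BoxBar X).Opens := pullback.snd (terminal.from X) (terminal.from P1.{u}) ⁻¹ᵁ
    Proj.basicOpen grading (MvPolynomial.X 1) with hU
  have hy : toBoxBar X y ∈ U := by
    have : toBoxBar X ⁻¹ᵁ U = ⊤ := by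
      rw [hU, ← Scheme.Hom.comp_preimage, toBoxBar, pullback.lift_snd,
        preimage_basicOpen_homogeneousPoint, Scheme.basicOpen_one]
    exact (show y ∈ toBoxBar X ⁻¹ᵁ U from this ▸ trivial)
  have hinf : Set.range (infinity X) ⊆ (U : Set (BoxBar X))ᶜ := by
    rintro _ ⟨x, rfl⟩ hx
    have : infinity X ⁻¹ᵁ U = ⊥ := by
      rw [hU, ← Scheme.Hom.comp_preimage, infinity, pullback.lift_snd,
        preimage_basicOpen_homogeneousPoint, Scheme.basicOpen_zero]
    have hx' : x ∈ infinity X ⁻¹ᵁ U := hx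
    rw [this] at hx'
    exact hx'
  intro hmem
  have h2 : toBoxBar X y ∈ ((infinity X).ker.support : Set (BoxBar X)) := hmem
  rw [Scheme.Hom.support_ker] at h2
  exact closure_minimal hinf U.isOpen.isClosed_compl h2 hy

/-- A closed subset satisfying the modulus condition along `D` does not meet `D × □¹`. -/
lemma SatisfiesModulus.proj_notMem {X : Scheme.{u}} [IsNoetherian X] {D : X.IdealSheafData}
    {W : Set (Box X)} (hW : IsClosed W) (h : SatisfiesModulus D W) {y : Box X} (hy : y ∈ W) :
    Box.proj X y ∉ D.support := by
  intro hyD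
  obtain ⟨η, hη, hηy⟩ := exists_isGenericIn hW hy
  have hsupp := Scheme.IdealSheafData.support_antitone (h η hη)
  set φ := normalizationMap (BoxBar X) (toBoxBar X η) with hφ
  have hcl : IsClosed (Set.range φ) := φ.isClosedMap.isClosed_range
  have hmem : toBoxBar X η ∈ Set.range φ := by
    refine ⟨((BoxBar X).fromSpecResidueField (toBoxBar X η)).toNormalization default, ?_⟩
    rw [hφ, ← Scheme.Hom.comp_apply, Scheme.Hom.toNormalization_fromNormalization,
      Scheme.fromSpecResidueField_apply]
  obtain ⟨n, hn⟩ := (hηy.map (toBoxBar X).continuous).mem_closed hcl hmem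
  have hn1 : n ∈ ((D.comap (pullback.fst (terminal.from X) (terminal.from P1.{u}))).comap
      φ).support := by
    rw [Scheme.IdealSheafData.support_comap, Scheme.IdealSheafData.support_comap]
    change pullback.fst (terminal.from X) (terminal.from P1.{u}) (φ n) ∈ D.support
    rw [hn, ← Scheme.Hom.comp_apply, toBoxBar, pullback.lift_fst]
    exact hyD
  have hn2 := hsupp hn1
  rw [Scheme.IdealSheafData.support_comap] at hn2
  change φ n ∈ (infinity X).ker.support at hn2
  rw [hn] at hn2
  exact toBoxBar_notMem_support y hn2

lemma proj_iota {X : Scheme.{u}} (q : ℤ) (x : X) : Box.proj X (iota X q x) = x := by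
  have : iota X q ≫ Box.proj X = 𝟙 X := AffineSpace.homOfVector_over _ _
  rw [← Scheme.Hom.comp_apply, this]
  rfl

lemma SatisfiesModulus.disjoint {X : Scheme.{u}} [IsNoetherian X] {D : X.IdealSheafData}
    {W : Closeds (Box X)} (h : SatisfiesModulus D (W : Set (Box X))) (q : ℤ) :
    Disjoint (W.preimage (iota X q).continuous : Set X) (D.support : Set X) := by
  refine Set.disjoint_left.2 fun x hx hxD => ?_
  have := h.proj_notMem W.isClosed (y := iota X q x) hx
  rw [proj_iota] at this
  exact this hxD

/-! ### Chow groups with modulus -/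

variable {X : Scheme.{u}}

/-- The points of `X` whose closure does not meet `D`. -/
def pointsOff (D : X.IdealSheafData) : Set X :=
  {v | Disjoint (closure {v}) (D.support : Set X)}

/-- The points of `X × □¹` whose closure is contained neither in `X × {0}` nor in `X × {1}` and
satisfies the modulus condition along `D`. (Over a base field these are the closures dominating the
affine line over that field, together with some lying over closed points other than `0` and `1`,
for which both fibres are empty.) -/
def modulusPoints (D : X.IdealSheafData) : Set (Box X) :=
  {w | w ∉ Set.range (iota X 0) ∧ w ∉ Set.range (iota X 1) ∧ SatisfiesModulus D (closure {w})}

/-- `Z^p(X|D)`. -/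
abbrev ModulusCycles (D : X.IdealSheafData) (p : ℤ) : Type u := Cycles X p (pointsOff D)

/-- `Z^p(X|D, 1)`. -/
abbrev ModulusCycles₁ (D : X.IdealSheafData) (p : ℤ) : Type u :=
  Cycles (Box X) p (modulusPoints D)

lemma preClosure_subset_pointsOff [IsNoetherian X] {D : X.IdealSheafData} (q : ℤ) {w : Box X}
    (hw : SatisfiesModulus D (closure {w})) :
    (preClosure (iota X q) w : Set X) ⊆ pointsOff D := fun _ hx =>
  (SatisfiesModulus.disjoint (W := Closeds.closure {w}) hw q).mono_left
    (closure_minimal (Set.singleton_subset_iff.2 hx) (preClosure (iota X q) w).isClosed)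

/-- `ι_q^* : Z^p(X|D, 1) → Z^p(X|D)` for `q = 0, 1`, sending `[W]` to the cycle of the fibre of `W`
over `t = q`. -/
def modulusPullback [IsNoetherian X] (D : X.IdealSheafData) (p q : ℤ) :
    ModulusCycles₁ D p →+ ModulusCycles D p :=
  Finsupp.liftAddHom fun w => zmultiplesHom (ModulusCycles D p)
    (Cycles.incl p (preClosure_subset_pointsOff q w.2.2.2.2) (intersectionCycle (iota X q) p w.1))

/-- The Chow group with modulus `CH^p(X|D)`, the cokernel of `ι_0^* - ι_1^*`. -/
abbrev ChowWithModulus [IsNoetherian X] (D : X.IdealSheafData) (p : ℤ) : Type u :=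
  ModulusCycles D p ⧸ (modulusPullback D p 0 - modulusPullback D p 1).range

/-- The class of a cycle in the Chow group with modulus. -/
def ChowWithModulus.mk [IsNoetherian X] (D : X.IdealSheafData) (p : ℤ) :
    ModulusCycles D p →+ ChowWithModulus D p :=
  QuotientAddGroup.mk' _

/-! ### The colimits over supports -/

/-- `S(X|D)`: the closed subsets of `X` not meeting `D`, ordered by inclusion. -/
abbrev Supports (D : X.IdealSheafData) : Type u :=
  {Y : Closeds X // Disjoint (Y : Set X) (D.support : Set X)}

/-- `S(X|D, 1)`: the closed subsets of `X × □¹` satisfying the modulus condition along `D`, ordered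
by inclusion. -/
abbrev Supports₁ (D : X.IdealSheafData) : Type u :=
  {Y : Closeds (Box X) // SatisfiesModulus D (Y : Set (Box X))}

lemma Supports.subset_pointsOff {D : X.IdealSheafData} (Y : Supports D) :
    (Y.1 : Set X) ⊆ pointsOff D := fun _ hx =>
  Y.2.mono_left (closure_minimal (Set.singleton_subset_iff.2 hx) Y.1.isClosed)

open Classical in
/-- The colimit of `CH^p_Y(X)` over `Y ∈ S(X|D)`. -/
abbrev ColimChow (D : X.IdealSheafData) (p : ℤ) : Type u :=
  AddCommGroup.DirectLimit (fun Y : Supports D => Chow X p Y.1) fun _ _ h => Chow.map p h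

open Classical in
/-- The structure map `CH^p_Y(X) → colim CH^p_Y(X)`. -/
abbrev ColimChow.of (D : X.IdealSheafData) (p : ℤ) (Y : Supports D) :
    Chow X p Y.1 →+ ColimChow D p :=
  AddCommGroup.DirectLimit.of (fun Y : Supports D => Chow X p Y.1) (fun _ _ h => Chow.map p h) Y

open Classical in
/-- The colimit of `Z^p_Y(X × □¹)` over `Y ∈ S(X|D, 1)`. -/
abbrev ColimCycles₁ (D : X.IdealSheafData) (p : ℤ) : Type u :=
  AddCommGroup.DirectLimit (fun Y : Supports₁ D => Cycles (Box X) p (Y.1 : Set (Box X)))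
    fun _ _ h => Cycles.incl p h

/-- The preimage `ι_q⁻¹(Y) ∈ S(X|D)` of `Y ∈ S(X|D, 1)`. -/
def Supports₁.fibre [IsNoetherian X] {D : X.IdealSheafData} (q : ℤ) (Y : Supports₁ D) :
    Supports D :=
  ⟨Y.1.preimage (iota X q).continuous, Y.2.disjoint q⟩

open Classical in
/-- The map `ι_q^* : colim Z^p_Y(X × □¹) → colim CH^p_Y(X)`. -/
def colimPullback [IsNoetherian X] (D : X.IdealSheafData) (p q : ℤ) :
    ColimCycles₁ D p →+ ColimChow D p :=
  AddCommGroup.DirectLimit.lift _ _ _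
    (fun Y => (ColimChow.of D p (Y.fibre q)).comp (pullbackHom (iota X q) p Y.1))
    fun Y Y' h z => by
      have h' : Y.fibre q ≤ Y'.fibre q := fun _ hx => h hx
      change ColimChow.of D p (Y'.fibre q) (pullbackHom (iota X q) p Y'.1 _) =
        ColimChow.of D p (Y.fibre q) (pullbackHom (iota X q) p Y.1 z)
      rw [pullbackHom_incl (iota X q) p h z]
      exact AddCommGroup.DirectLimit.of_f (f := fun (Y Y' : Supports D) h => Chow.map p h) h' _

end

end ChowMod

/-! The point is that rational equivalence and equivalence with modulus differ only by what the
irreducible subsets of `X × □¹` in the supports contribute. Three facts carry the argument.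

Divisors are differences of fibres. For `f ∈ κ(w)ˣ` with `f ≠ 1`, the graph of `t = f / (f - 1)`
over the closure of `w` has fibres over `t = 0` and `t = 1` whose difference is `div f`
(`isDiv_apply_eq_sub`). Locally this is an identity of lengths over a noetherian domain `A` of
dimension at most one (`length_fibreIdeal_sub`). With `f = a / b`, `c = a - b` and `I = (a, c)`, the
fibre over `0` has length `ℓ(A/Iⁿ) - ℓ(A/Iⁿ⁺¹) + ord a` for large `n`. Since `(b, c) = I`, the fibre
over `1` has the same length with `ord b` in place of `ord a`, and the terms in `I` cancel. If the
closure of `w` misses `D`, then so does everything over it, and the graph satisfies the modulus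
condition for trivial reasons (`satisfiesModulus_closure_singleton`). Hence `ε` exists.

The modulus condition passes to irreducible closed subsets (`SatisfiesModulus.closure_singleton`).
On a normalization, divisibility by a local equation `d` of `D` is a monic equation homogeneous in
`e` and `d`, and such an equation survives specialization (`exists_integral_mul_of_ker_le`). So each
generator of `Z^p_Y(X × □¹)` lying in neither fibre is a generator of `Z^p(X|D, 1)`, with the same
boundary.

The remaining generators contribute nothing. A subset of the fibre over `q ∈ {0, 1}` does not meet
the other fibre, and its class over `q` vanishes because `t - q` trivializes the normal bundle
(`IsDivOfNormalBundle.mem_principalCycles`).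

Exactness is then formal: both boundary maps have the same image in cycles, and the colimit over
supports is filtered. -/

namespace ChowMod

noncomputable section

/-! ### Lengths of the fibres of a graph over a one-dimensional domain -/

open Polynomial in
/-- The values at `t = q` of the polynomials that vanish at `t = g`. -/
def fibreIdeal {A K : Type*} [CommRing A] [CommRing K] (φ : A →+* K) (g : K) (q : A) : Ideal A :=
  (RingHom.ker (eval₂RingHom φ g)).map (evalRingHom q)

section Algebra

open Polynomial
open scoped Pointwise

variable {A K : Type*} [CommRing A]

lemma mem_fibreIdeal [CommRing K] {φ : A →+* K} {g : K} {q e : A} :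
    e ∈ fibreIdeal φ g q ↔ ∃ N : A[X], N.eval₂ φ g = 0 ∧ N.eval q = e := by
  rw [fibreIdeal, Ideal.mem_map_iff_of_surjective _ fun x => ⟨C x, by simp⟩]
  rfl

/-- The translation `t ↦ t + q` reduces every fibre to the one over `t = 0`. -/
lemma fibreIdeal_eq_sub [CommRing K] (φ : A →+* K) (g : K) (q : A) :
    fibreIdeal φ g q = fibreIdeal φ (g - φ q) 0 := by
  ext e
  simp only [mem_fibreIdeal]
  constructor
  · rintro ⟨N, h, rfl⟩
    exact ⟨N.comp (X + C q), by simp [eval₂_comp, h], by simp⟩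
  · rintro ⟨N, h, rfl⟩
    exact ⟨N.comp (X - C q), by simp [eval₂_comp, h], by simp⟩

/-- Among the monomials of degree `n + 1` in `a` and `c`, only `c ^ (n + 1)` is not `a` times a
monomial of degree `n`. -/
lemma span_pair_pow_succ (a c : A) (n : ℕ) :
    Ideal.span {a, c} ^ (n + 1) = Ideal.span {a} * Ideal.span {a, c} ^ n ⊔ Ideal.span {c ^ (n + 1)} := by
  induction n with
  | zero => simp [Ideal.span_insert]
  | succ n ih =>
    have h : Ideal.span {c} * (Ideal.span {a} * Ideal.span {a, c} ^ n) ≤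
        Ideal.span {a} * Ideal.span {a, c} ^ (n + 1) := by
      rw [mul_left_comm, pow_succ']
      exact Ideal.mul_mono_right (Ideal.mul_mono_left (Ideal.span_mono (by simp)))
    have h' : Ideal.span {a, c} ^ (n + 1 + 1) = Ideal.span {a} * Ideal.span {a, c} ^ (n + 1) ⊔
        Ideal.span {c} * Ideal.span {a, c} ^ (n + 1) := by
      rw [pow_succ' _ (n + 1), ← Ideal.sup_mul, ← Ideal.span_insert]
    rw [h']
    conv_lhs => enter [2]; rw [ih]
    rw [Ideal.mul_sup, ← sup_assoc, sup_eq_left.2 h, Ideal.span_singleton_mul_span_singleton,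
      ← pow_succ']

/-- The ideal of `e` with `e c^(n+1) ∈ a (a, c)^n`. -/
def stageIdeal (a c : A) (n : ℕ) : Ideal A :=
  Submodule.comap (LinearMap.mulLeft A (c ^ (n + 1))) (Ideal.span {a} * Ideal.span {a, c} ^ n)

lemma mem_stageIdeal {a c e : A} {n : ℕ} :
    e ∈ stageIdeal a c n ↔ c ^ (n + 1) * e ∈ Ideal.span {a} * Ideal.span {a, c} ^ n := Iff.rfl

lemma stageIdeal_mono (a c : A) : Monotone (stageIdeal a c) := by
  refine monotone_nat_of_le_succ fun n e he => ?_
  rw [mem_stageIdeal] at he ⊢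
  have h := Ideal.mul_mem_mul (Ideal.subset_span (by simp : c ∈ ({a, c} : Set A))) he
  rw [mul_left_comm, ← pow_succ' (Ideal.span {a, c}), ← mul_assoc, ← pow_succ'] at h
  exact h

/-- Write `I = (a, c)`. Two short exact sequences compute the length of `A / aIⁿ`: multiplication by
`a` embeds `A / Iⁿ` with cokernel `A / a`, and multiplication by `c ^ (n + 1)` embeds `A /
stageIdeal a c n` with cokernel `A / Iⁿ⁺¹`. -/
lemma length_stageIdeal_add [IsDomain A] {a : A} (c : A) (ha : a ≠ 0) (n : ℕ) :
    Module.length A (A ⧸ stageIdeal a c n) + Module.length A (A ⧸ Ideal.span {a, c} ^ (n + 1)) =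
      Module.length A (A ⧸ Ideal.span {a, c} ^ n) + Ring.ord A a := by
  have hmul : a • (Ideal.span {a, c} ^ n) = Ideal.span {a} * Ideal.span {a, c} ^ n := by
    rw [← Submodule.ideal_span_singleton_smul, smul_eq_mul]
  have h1 := Module.length_eq_add_of_exact (Ideal.mulQuot a (Ideal.span {a, c} ^ n))
    (Ideal.quotOfMul a _) (Ideal.mulQuot_injective _ (mem_nonZeroDivisors_of_ne_zero ha))
    (Ideal.quotOfMul_surjective _) (Ideal.exact_mulQuot_quotOfMul _)
  rw [Ring.ord, ← h1]
  have hle : a • (Ideal.span {a, c} ^ n) ≤ Ideal.span {a, c} ^ (n + 1) := by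
    rw [hmul, span_pair_pow_succ]; exact le_sup_left
  have hst : stageIdeal a c n =
      Submodule.comap (LinearMap.mulLeft A (c ^ (n + 1))) (a • (Ideal.span {a, c} ^ n)) := by
    rw [hmul]; rfl
  let m : (A ⧸ stageIdeal a c n) →ₗ[A] A ⧸ a • (Ideal.span {a, c} ^ n) :=
    Submodule.mapQ _ _ (LinearMap.mulLeft A (c ^ (n + 1))) hst.le
  refine (Module.length_eq_add_of_exact m (Submodule.factor hle) ?_
    (Submodule.factor_surjective hle) ?_).symm
  · rw [← LinearMap.ker_eq_bot]
    refine Submodule.ker_liftQ_eq_bot' _ _ ?_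
    rw [LinearMap.ker_comp, Submodule.ker_mkQ, hst]
  · intro x
    obtain ⟨x, rfl⟩ := Submodule.Quotient.mk_surjective _ x
    constructor
    · intro hx
      have hx' : x ∈ Ideal.span {a, c} ^ (n + 1) := (Submodule.Quotient.mk_eq_zero _).1 hx
      rw [span_pair_pow_succ, ← hmul] at hx'
      obtain ⟨y, hy, z, hz, rfl⟩ := Submodule.mem_sup.1 hx'
      obtain ⟨w, rfl⟩ := Ideal.mem_span_singleton.1 hz
      refine ⟨Submodule.Quotient.mk w, ?_⟩
      change Submodule.Quotient.mk (c ^ (n + 1) * w) = _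
      rw [eq_comm, Submodule.Quotient.eq]
      simpa using hy
    · rintro ⟨w, hw⟩
      obtain ⟨w, rfl⟩ := Submodule.Quotient.mk_surjective _ w
      rw [← hw]
      change Submodule.Quotient.mk (c ^ (n + 1) * w) = _
      rw [Submodule.Quotient.mk_eq_zero]
      exact Ideal.mul_mem_right _ _ (Ideal.pow_mem_pow (Ideal.subset_span (by simp)) _)

/-- For `c ≠ 0` this says that a form of degree `n` in `a` and `c` becomes a polynomial in `g = a /
c` after division by `c ^ n`. The next lemma is the converse, in degree at most `n`. -/
lemma exists_eval₂_of_mem_pow [Field K] {φ : A →+* K} {a c : A} {g : K} (hg : g * φ c = φ a)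
    {n : ℕ} {y : A} (hy : y ∈ Ideal.span {a, c} ^ n) :
    ∃ M : A[X], φ y = φ c ^ n * M.eval₂ φ g := by
  induction n generalizing y with
  | zero => exact ⟨C y, by simp⟩
  | succ n ih =>
    rw [pow_succ'] at hy
    refine Submodule.mul_induction_on hy (fun r hr s hs => ?_) ?_
    · obtain ⟨x, z, rfl⟩ := Ideal.mem_span_pair.1 hr
      obtain ⟨M, hM⟩ := ih hs
      refine ⟨(C x * X + C z) * M, ?_⟩
      simp only [map_mul, map_add, hM, eval₂_mul, eval₂_add, eval₂_C, eval₂_X, ← hg]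
      ring
    · rintro r s ⟨M, hM⟩ ⟨M', hM'⟩
      exact ⟨M + M', by simp [hM, hM', mul_add]⟩

lemma exists_mem_pow_of_eval₂ [Field K] {φ : A →+* K} {a c : A} {g : K} (hg : g * φ c = φ a)
    {n : ℕ} (M : A[X]) (hM : M.natDegree ≤ n) :
    ∃ y ∈ Ideal.span {a, c} ^ n, φ y = φ c ^ n * M.eval₂ φ g := by
  induction n generalizing M with
  | zero =>
    obtain ⟨x, rfl⟩ := natDegree_eq_zero.1 (Nat.le_zero.1 hM)
    exact ⟨x, by simp, by simp⟩
  | succ n ih =>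
    obtain ⟨y, hy, hy'⟩ := ih M.divX (by rw [natDegree_divX_eq_natDegree_tsub_one]; omega)
    refine ⟨a * y + c ^ (n + 1) * M.coeff 0, add_mem ?_ ?_, ?_⟩
    · rw [pow_succ']
      exact Ideal.mul_mem_mul (Ideal.subset_span (by simp)) hy
    · exact Ideal.mul_mem_right _ _ (Ideal.pow_mem_pow (Ideal.subset_span (by simp)) _)
    · conv_rhs => rw [← divX_mul_X_add M]
      simp only [map_add, map_mul, hy', eval₂_add, eval₂_mul, eval₂_X, eval₂_C, ← hg, map_pow]
      ring

/-- The fibre ideal over `0` is `A ∩ g A[g]`. Bounding the degree of the cofactor of `g` by `n` and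
clearing the denominator `c ^ (n + 1)` gives the `n`-th stage. -/
lemma mem_fibreIdeal_zero_iff [Field K] {φ : A →+* K} (hφ : Function.Injective φ) {a c : A} {g : K}
    (hc : c ≠ 0) (hg : g * φ c = φ a) {e : A} :
    e ∈ fibreIdeal φ g 0 ↔ ∃ n, e ∈ stageIdeal a c n := by
  have hc' : φ c ≠ 0 := (map_ne_zero_iff φ hφ).2 hc
  rw [mem_fibreIdeal]
  constructor
  · rintro ⟨N, hN, rfl⟩
    obtain ⟨y, hy, hy'⟩ := exists_mem_pow_of_eval₂ hg N.divX le_rfl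
    refine ⟨N.divX.natDegree, ?_⟩
    have : c ^ (N.divX.natDegree + 1) * N.eval 0 = a * -y := by
      apply hφ
      rw [← coeff_zero_eq_eval_zero]
      have h : N.divX.eval₂ φ g * g + φ (N.coeff 0) = 0 := by
        rw [← hN]
        conv_rhs => rw [← divX_mul_X_add N]
        simp
      simp only [map_mul, map_neg, map_pow, hy', ← hg, eq_neg_of_add_eq_zero_right h]
      ring
    rw [mem_stageIdeal, this]
    exact Ideal.mul_mem_mul (Ideal.mem_span_singleton_self a) (neg_mem hy)
  · rintro ⟨n, hn⟩
    obtain ⟨y, hy, hy'⟩ := Ideal.mem_span_singleton_mul.1 (mem_stageIdeal.1 hn)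
    obtain ⟨M, hM⟩ := exists_eval₂_of_mem_pow hg hy
    refine ⟨C e - X * M, ?_, by simp⟩
    have h := congrArg φ hy'
    simp only [map_mul, map_pow, hM, ← hg] at h
    have h2 : φ c ^ (n + 1) * (φ e - g * M.eval₂ φ g) = 0 := by linear_combination -h
    simpa [hc'] using h2

lemma length_quotient_ne_top [IsDomain A] [IsNoetherianRing A] [Ring.KrullDimLE 1 A] {I : Ideal A}
    (hI : I ≠ ⊥) : Module.length A (A ⧸ I) ≠ ⊤ := by
  obtain ⟨x, hx, hx0⟩ := Submodule.exists_mem_ne_zero_of_ne_bot hI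
  have h := Ring.ord_ne_top (mem_nonZeroDivisors_of_ne_zero hx0)
  have hle : Ideal.span {x} ≤ I := (Ideal.span_singleton_le_iff_mem I).2 hx
  exact ne_top_of_le_ne_top h
    (Module.length_le_of_surjective (Submodule.factor hle) (Submodule.factor_surjective hle))

/-- The stages increase to the fibre ideal, so by noetherianity they equal it from some `n₀` on. -/
lemma eventually_length_fibreIdeal_add [IsDomain A] [IsNoetherianRing A] [Field K] {φ : A →+* K}
    (hφ : Function.Injective φ) {a c : A} {g : K} (ha : a ≠ 0) (hc : c ≠ 0)
    (hg : g * φ c = φ a) :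
    ∃ n₀, ∀ n ≥ n₀, Module.length A (A ⧸ fibreIdeal φ g 0) +
      Module.length A (A ⧸ Ideal.span {a, c} ^ (n + 1)) =
      Module.length A (A ⧸ Ideal.span {a, c} ^ n) + Ring.ord A a := by
  obtain ⟨n₀, h⟩ := WellFoundedGT.monotone_chain_condition
    (⟨stageIdeal a c, stageIdeal_mono a c⟩ : ℕ →o Ideal A)
  refine ⟨n₀, fun n hn => ?_⟩
  rw [← length_stageIdeal_add c ha n]
  have : fibreIdeal φ g 0 = stageIdeal a c n := by
    ext e
    rw [mem_fibreIdeal_zero_iff hφ hc hg]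
    refine ⟨fun ⟨m, hm⟩ => ?_, fun h => ⟨n, h⟩⟩
    have h1 : stageIdeal a c n₀ = stageIdeal a c n := h n hn
    have h2 : stageIdeal a c n₀ = stageIdeal a c (max m n₀) := h (max m n₀) (le_max_right _ _)
    rw [← h1, h2]
    exact stageIdeal_mono a c (le_max_left m n₀) hm
  rw [this]

/-- The fibres over `t = 0` and `t = 1` of the graph `t = f / (f - 1)` differ by the divisor of
`f = a / b`. -/
lemma length_fibreIdeal_sub [IsDomain A] [IsNoetherianRing A] [Ring.KrullDimLE 1 A] [Field K]
    {φ : A →+* K} (hφ : Function.Injective φ) {a b : A} {g : K} (ha : a ≠ 0) (hb : b ≠ 0)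
    (hab : a ≠ b) (hg : g * (φ a - φ b) = φ a) :
    ((Module.length A (A ⧸ fibreIdeal φ g 0)).toNat : ℤ) -
      (Module.length A (A ⧸ fibreIdeal φ g 1)).toNat =
      (Ring.ord A a).toNat - (Ring.ord A b).toNat := by
  have hc : a - b ≠ 0 := sub_ne_zero.2 hab
  obtain ⟨n₀, h₀⟩ := eventually_length_fibreIdeal_add hφ ha hc (g := g) (by rw [map_sub, hg])
  -- Moving `t = 1` to `t = 0` replaces `g = a / (a - b)` by `g - 1 = b / (a - b)`, with the same
  -- denominator.
  obtain ⟨n₁, h₁⟩ := eventually_length_fibreIdeal_add hφ hb hc (g := g - φ 1)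
    (by rw [map_sub, map_one, sub_mul, hg]; ring)
  rw [← fibreIdeal_eq_sub] at h₁
  -- Both fibres thus involve powers of one ideal, whose colengths cancel in the difference.
  have hI : Ideal.span {b, a - b} = Ideal.span {a, a - b} := by
    refine le_antisymm (Ideal.span_le.2 ?_) (Ideal.span_le.2 ?_) <;>
      rintro x (rfl | rfl) <;> rw [SetLike.mem_coe, Ideal.mem_span_pair]
    · exact ⟨1, -1, by ring⟩
    · exact ⟨0, 1, by ring⟩
    · exact ⟨1, 1, by ring⟩
    · exact ⟨0, 1, by ring⟩
  replace h₀ := h₀ (max n₀ n₁) (le_max_left _ _)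
  replace h₁ := h₁ (max n₀ n₁) (le_max_right _ _)
  rw [hI] at h₁
  have hne : Ideal.span {a, a - b} ≠ ⊥ := fun h => ha <| by
    have : a ∈ Ideal.span {a, a - b} := Ideal.subset_span (by simp)
    simpa [h] using this
  -- Dimension at most one makes every length finite, so that the two identities may be subtracted
  -- in `ℤ`.
  have hfin (m : ℕ) := length_quotient_ne_top (pow_ne_zero m hne)
  have ha' := Ring.ord_ne_top (mem_nonZeroDivisors_of_ne_zero ha)
  have hb' := Ring.ord_ne_top (mem_nonZeroDivisors_of_ne_zero hb)
  have hx := hfin (max n₀ n₁)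
  have hy := hfin (max n₀ n₁ + 1)
  generalize Module.length A (A ⧸ Ideal.span {a, a - b} ^ (max n₀ n₁ + 1)) = y at *
  generalize Module.length A (A ⧸ Ideal.span {a, a - b} ^ (max n₀ n₁)) = x at *
  generalize Ring.ord A a = oa at *
  generalize Ring.ord A b = ob at *
  generalize Module.length A (A ⧸ fibreIdeal φ g 0) = l₀ at *
  generalize Module.length A (A ⧸ fibreIdeal φ g 1) = l₁ at *
  lift x to ℕ using hx
  lift y to ℕ using hy
  lift oa to ℕ using ha'
  lift ob to ℕ using hb'
  have e₀ : l₀ ≠ ⊤ := by rintro rfl; simp at h₀; exact ENat.natCast_ne_top _ (by exact_mod_cast h₀.symm)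
  have e₁ : l₁ ≠ ⊤ := by rintro rfl; simp at h₁; exact ENat.natCast_ne_top _ (by exact_mod_cast h₁.symm)
  lift l₀ to ℕ using e₀
  lift l₁ to ℕ using e₁
  norm_cast at h₀ h₁
  simp only [ENat.toNat_natCast]
  omega

end Algebra

end

end ChowMod

/-! ### Pull-back of ideal sheaves on affine opens -/

namespace ChowMod

lemma ideal_comap_of_isOpenImmersion {X Y : Scheme.{u}} (J : Y.IdealSheafData) (i : X ⟶ Y)
    [IsOpenImmersion i] (U : Y.affineOpens) (W : X.affineOpens) (h : W.1 ≤ i ⁻¹ᵁ U.1) :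
    (J.comap i).ideal W = (J.ideal U).map (i.appLE U.1 W.1 h).hom := by
  have hle : i ''ᵁ W.1 ≤ U.1 := by
    rintro _ ⟨x, hx, rfl⟩
    exact h hx
  rw [Scheme.IdealSheafData.ideal_comap_of_isOpenImmersion,
    ← J.map_ideal' (U := ⟨i ''ᵁ W.1, W.2.image_of_isOpenImmersion i⟩) (V := U) (homOfLE hle).op,
    ← i.map_appLE (show W.1 ≤ i ⁻¹ᵁ i ''ᵁ W.1 from fun x hx => ⟨x, hx, rfl⟩) (homOfLE hle).op,
    CommRingCat.hom_comp, ← Ideal.map_map, ← Scheme.Hom.appIso_hom']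
  exact Ideal.comap_symm (i.appIso W.1).commRingCatIsoToRingEquiv

/-- Both inclusions come from the adjunction between pull-back and push-forward, the latter being
contraction along an affine morphism. -/
lemma ideal_comap_top {X Y : Scheme.{u}} [IsAffine X] [IsAffine Y] (J : Y.IdealSheafData)
    (f : X ⟶ Y) :
    (J.comap f).ideal ⟨⊤, isAffineOpen_top X⟩ =
      (J.ideal ⟨⊤, isAffineOpen_top Y⟩).map f.appTop.hom := by
  have hK (K : Ideal Γ(X, ⊤)) :
      (Scheme.IdealSheafData.ofIdealTop K).ideal ⟨⊤, isAffineOpen_top X⟩ = K :=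
    Scheme.IdealSheafData.equivOfIsAffine.right_inv K
  apply le_antisymm
  · have : J.comap f ≤ .ofIdealTop ((J.ideal ⟨⊤, isAffineOpen_top Y⟩).map f.appTop.hom) := by
      rw [← Scheme.IdealSheafData.le_map_iff_comap_le]
      refine Scheme.IdealSheafData.le_of_isAffine ?_
      rw [Scheme.IdealSheafData.ideal_map_of_isAffineHom, ← Ideal.map_le_iff_le_comap]
      exact (hK _).ge
    exact (this _).trans (hK _).le
  · rw [Ideal.map_le_iff_le_comap]
    have := (Scheme.IdealSheafData.le_map_comap J f) ⟨⊤, isAffineOpen_top Y⟩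
    rwa [Scheme.IdealSheafData.ideal_map_of_isAffineHom] at this

lemma fromSpec_appLE_top {X : Scheme.{u}} {U : X.Opens} (hU : IsAffineOpen U)
    (h : ⊤ ≤ hU.fromSpec ⁻¹ᵁ U) :
    hU.fromSpec.appLE U ⊤ h = (Scheme.ΓSpecIso Γ(X, U)).inv := by
  rw [Scheme.Hom.appLE, hU.fromSpec_app_self, Category.assoc, ← Functor.map_comp]
  exact (congrArg _ ((Spec Γ(X, U)).presheaf.map_id _)).trans (Category.comp_id _)

lemma ideal_comap {X Y : Scheme.{u}} (J : Y.IdealSheafData) (f : X ⟶ Y)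
    (U : Y.affineOpens) (V : X.affineOpens) (h : V.1 ≤ f ⁻¹ᵁ U.1) :
    (J.comap f).ideal V = (J.ideal U).map (f.appLE U.1 V.1 h).hom := by
  obtain ⟨U, hU⟩ := U
  obtain ⟨V, hV⟩ := V
  have hU : IsAffineOpen U := hU
  have hV : IsAffineOpen V := hV
  change V ≤ f ⁻¹ᵁ U at h
  have e := ideal_comap_top (J.comap hU.fromSpec) (Spec.map (f.appLE U V h))
  have hV' : (⊤ : (Spec Γ(X, V)).Opens) ≤ hV.fromSpec ⁻¹ᵁ V := by simp
  have hU' : (⊤ : (Spec Γ(Y, U)).Opens) ≤ hU.fromSpec ⁻¹ᵁ U := by simp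
  have hA := ideal_comap_of_isOpenImmersion (J.comap f) hV.fromSpec ⟨V, hV⟩
    ⟨⊤, isAffineOpen_top _⟩ hV'
  have hB := ideal_comap_of_isOpenImmersion J hU.fromSpec ⟨U, hU⟩
    ⟨⊤, isAffineOpen_top _⟩ hU'
  have hC : (J.comap hU.fromSpec).comap (Spec.map (f.appLE U V h)) =
      (J.comap f).comap hV.fromSpec := by
    rw [← Scheme.IdealSheafData.comap_comp, hU.SpecMap_appLE_fromSpec f hV,
      Scheme.IdealSheafData.comap_comp]
  rw [hC, hA, hB] at e
  simp only [fromSpec_appLE_top, Ideal.map_map, ← CommRingCat.hom_comp] at e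
  rw [← Scheme.ΓSpecIso_inv_naturality, CommRingCat.hom_comp, ← Ideal.map_map] at e
  have h3 := congrArg (Ideal.map (Scheme.ΓSpecIso Γ(X, V)).hom.hom) e
  simpa only [Ideal.map_map, ← CommRingCat.hom_comp, Category.assoc, Iso.inv_hom_id,
    Category.comp_id, CommRingCat.hom_id, Ideal.map_id] using h3

end ChowMod

/-! ### The modulus condition on irreducible closed subsets -/

namespace ChowMod

/-- If `P` is a monic equation of `b`, then `e = d b` satisfies the equation with roots scaled by
`d`. This equation has coefficients in `A` and no longer mentions `b`, so it passes to every
quotient with larger kernel; over a field, dividing by `d` recovers an integral element. -/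
lemma exists_integral_mul_of_ker_le {A B B' : Type*} [CommRing A] [CommRing B] [CommRing B']
    (ψ : A →+* B) (ψ' : A →+* B') (hB' : Subsingleton B' ∨ IsField B')
    (hker : RingHom.ker ψ ≤ RingHom.ker ψ') {d e : A}
    (h : ∃ b, ψ.IsIntegralElem b ∧ ψ e = ψ d * b) :
    ∃ b, ψ'.IsIntegralElem b ∧ ψ' e = ψ' d * b := by
  obtain ⟨b, ⟨P, hP, hPb⟩, hb⟩ := h
  rcases hB' with hB' | hB'
  · exact ⟨0, ψ'.isIntegralElem_zero, Subsingleton.elim _ _⟩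
  let := hB'.toField
  have h1 : ψ ((P.scaleRoots d).eval e) = 0 := by
    rw [← Polynomial.eval₂_at_apply, hb]
    exact Polynomial.scaleRoots_eval₂_eq_zero ψ hPb
  have h2 : ψ' ((P.scaleRoots d).eval e) = 0 := hker h1
  rw [← Polynomial.eval₂_at_apply] at h2
  by_cases hd : ψ' d = 0
  -- When `d` vanishes, the scaled equation degenerates to `e ^ n = 0`.
  · refine ⟨0, ψ'.isIntegralElem_zero, ?_⟩
    rw [← Polynomial.eval_map, Polynomial.map_scaleRoots _ _ _ (by simp [hP.leadingCoeff]), hd,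
      Polynomial.scaleRoots_zero] at h2
    rw [(hP.map ψ').leadingCoeff, one_smul, Polynomial.eval_pow, Polynomial.eval_X] at h2
    rw [hd, zero_mul]
    exact eq_zero_of_pow_eq_zero h2
  · refine ⟨ψ' e / ψ' d, ⟨P, hP, ?_⟩, by field_simp⟩
    rw [← mul_div_cancel₀ (ψ' e) hd, Polynomial.scaleRoots_eval₂_mul] at h2
    exact (mul_eq_zero.1 h2).resolve_left (pow_ne_zero _ hd)

lemma app_eq_zero_iff_notMem_basicOpen {K : Type u} [Field K] {Z : Scheme.{u}}
    (j : Spec (.of K) ⟶ Z) (U : Z.Opens) (s : Γ(Z, U)) :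
    j.app U s = 0 ↔ j default ∉ Z.basicOpen s := by
  rw [← AlgebraicGeometry.basicOpen_eq_bot_iff, ← Scheme.preimage_basicOpen]
  constructor
  · intro h hη
    have : (default : Spec (.of K)) ∈ j ⁻¹ᵁ Z.basicOpen s := hη
    rw [h] at this
    exact this
  · intro h
    refine eq_bot_iff.2 fun x hx => h ?_
    rw [Subsingleton.elim x default] at hx
    exact hx

lemma subsingleton_or_isField_sections {K : Type u} [Field K] (W : (Spec (.of K)).Opens) :
    Subsingleton Γ(Spec (.of K), W) ∨ IsField Γ(Spec (.of K), W) := by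
  by_cases h : (default : Spec (.of K)) ∈ W
  · right
    obtain rfl : W = ⊤ := eq_top_iff.2 fun x _ => by rwa [Subsingleton.elim x default]
    exact (Scheme.ΓSpecIso (.of K)).commRingCatIsoToRingEquiv.toMulEquiv.isField (Field.toIsField K)
  · left
    obtain rfl : W = ⊥ := eq_bot_iff.2 fun x hx => h (by rwa [Subsingleton.elim default x])
    infer_instance

/-- Over an affine open `U`, the functions on the normalization are the elements integral over `Γ(Z,
U)`. The inclusion of ideals thus means divisibility by `d` with an integral quotient. -/
lemma comap_normalizationMap_ideal_le_iff {Z : Scheme.{u}} (I J : Z.IdealSheafData) (η : Z)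
    (U : Z.affineOpens) (d : Γ(Z, U.1)) (hd : J.ideal U = Ideal.span {d}) :
    (I.comap (normalizationMap Z η)).ideal ⟨normalizationMap Z η ⁻¹ᵁ U.1, U.2.preimage _⟩ ≤
      (J.comap (normalizationMap Z η)).ideal ⟨normalizationMap Z η ⁻¹ᵁ U.1, U.2.preimage _⟩ ↔
    ∀ e ∈ I.ideal U, ∃ b, ((Z.fromSpecResidueField η).app U.1).hom.IsIntegralElem b ∧
      (Z.fromSpecResidueField η).app U.1 e = (Z.fromSpecResidueField η).app U.1 d * b := by
  obtain ⟨U, hU⟩ := U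
  have hU : IsAffineOpen U := hU
  set f := Z.fromSpecResidueField η
  have hI := ideal_comap I f.fromNormalization ⟨U, hU⟩
    ⟨f.fromNormalization ⁻¹ᵁ U, hU.preimage _⟩ le_rfl
  have hJ := ideal_comap J f.fromNormalization ⟨U, hU⟩
    ⟨f.fromNormalization ⁻¹ᵁ U, hU.preimage _⟩ le_rfl
  refine (iff_of_eq (congrArg₂ _ hI hJ)).trans ?_
  rw [hd, Ideal.map_le_iff_le_comap]
  refine forall₂_congr fun e he => ?_
  let := (f.app U).hom.toAlgebra
  rw [Ideal.mem_comap, Ideal.map_span, Set.image_singleton, Ideal.mem_span_singleton,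
    ← Scheme.Hom.app_eq_appLE, f.fromNormalization_app hU]
  have hinj : Function.Injective (f.normalizationObjIso hU).inv :=
    (f.normalizationObjIso hU).symm.commRingCatIsoToRingEquiv.injective
  have hsurj : Function.Surjective (f.normalizationObjIso hU).inv :=
    (f.normalizationObjIso hU).symm.commRingCatIsoToRingEquiv.surjective
  constructor
  · rintro ⟨b, hb⟩
    obtain ⟨b, rfl⟩ := hsurj b
    have hb' : algebraMap Γ(Z, U) (integralClosure Γ(Z, U) Γ(Spec (Z.residueField η), f ⁻¹ᵁ U)) e =
        algebraMap Γ(Z, U) (integralClosure Γ(Z, U) Γ(Spec (Z.residueField η), f ⁻¹ᵁ U)) d * b :=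
      hinj (hb.trans (map_mul (f.normalizationObjIso hU).inv.hom _ _).symm)
    exact ⟨b.1, b.2, congrArg Subtype.val hb'⟩
  · rintro ⟨b, hb, hb'⟩
    refine ⟨(f.normalizationObjIso hU).inv ⟨b, hb⟩, ?_⟩
    refine Eq.trans ?_ (map_mul (f.normalizationObjIso hU).inv.hom _ _)
    exact congrArg (f.normalizationObjIso hU).inv (Subtype.ext hb')

/-- A function vanishing at `η` also vanishes at its specialization `η'`. This is the inclusion of
kernels needed to transport the integral equations, without comparing the two normalizations. -/
lemma comap_normalizationMap_le_of_specializes {Z : Scheme.{u}} {I J : Z.IdealSheafData}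
    (hJ : ∀ x : Z, ∃ U : Z.affineOpens, x ∈ U.1 ∧ ∃ d, J.ideal U = Ideal.span {d})
    {η η' : Z} (h : η ⤳ η')
    (hη : I.comap (normalizationMap Z η) ≤ J.comap (normalizationMap Z η)) :
    I.comap (normalizationMap Z η') ≤ J.comap (normalizationMap Z η') := by
  choose U hU d hd using hJ
  refine Scheme.IdealSheafData.le_of_iSup_eq_top
    (fun x => ⟨normalizationMap Z η' ⁻¹ᵁ (U x).1, (U x).2.preimage _⟩) ?_ fun x => ?_
  · exact eq_top_iff.2 fun y _ => Opens.mem_iSup.2 ⟨normalizationMap Z η' y, hU _⟩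
  · rw [comap_normalizationMap_ideal_le_iff I J η' (U x) (d x) (hd x)]
    intro e he
    refine exists_integral_mul_of_ker_le ((Z.fromSpecResidueField η).app (U x).1).hom _
      (subsingleton_or_isField_sections (K := Z.residueField η') _) (fun s hs => ?_)
      ((comap_normalizationMap_ideal_le_iff I J η (U x) (d x) (hd x)).1 (hη _) e he)
    have h1 := (app_eq_zero_iff_notMem_basicOpen (K := Z.residueField η) _ (U x).1 s).1 hs
    refine (app_eq_zero_iff_notMem_basicOpen (K := Z.residueField η') _ (U x).1 s).2 fun h2 => h1 ?_
    rw [Scheme.fromSpecResidueField_apply] at h2 ⊢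
    exact h.mem_open (Z.basicOpen s).isOpen h2

lemma IsEffectiveCartier.exists_ideal_comap_eq_span {X Y : Scheme.{u}} {D : X.IdealSheafData} (hD : IsEffectiveCartier D)
    (f : Y ⟶ X) (y : Y) :
    ∃ U : Y.affineOpens, y ∈ U.1 ∧ ∃ d, (D.comap f).ideal U = Ideal.span {d} := by
  obtain ⟨U, hU, d, -, hd⟩ := hD (f y)
  obtain ⟨V, hV, hyV, hVU⟩ := Y.isBasis_affineOpens.exists_subset_of_mem_open
    (show y ∈ (f ⁻¹ᵁ U.1 : Set Y) from hU) (f ⁻¹ᵁ U.1).isOpen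
  obtain ⟨V, hV, rfl⟩ := hV
  refine ⟨⟨V, hV⟩, hyV, f.appLE U.1 V hVU d, ?_⟩
  rw [ideal_comap D f U ⟨V, hV⟩ hVU, hd, Ideal.map_span, Set.image_singleton]

lemma IsGenericIn.eq_of_closure {X : Scheme.{u}} {w x : X} (h : IsGenericIn (closure {w}) x) : x = w :=
  (h.2 w (subset_closure rfl) (specializes_iff_mem_closure.2 h.1)).symm

/-- The modulus condition is inherited by irreducible closed subsets. -/
lemma SatisfiesModulus.closure_singleton {X : Scheme.{u}} {D : X.IdealSheafData} (hD : IsEffectiveCartier D)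
    {W : Set (Box X)} (hW : IsClosed W) (h : SatisfiesModulus D W) {y : Box X} (hy : y ∈ W) :
    SatisfiesModulus D (closure {y}) := by
  intro x hx
  obtain rfl := hx.eq_of_closure
  obtain ⟨η, hη, hηy⟩ := exists_isGenericIn hW hy
  exact comap_normalizationMap_le_of_specializes (hD.exists_ideal_comap_eq_span _)
    (hηy.map (toBoxBar X).continuous) (h η hη)

/-- The modulus condition holds for closed subsets that lie over the complement of `D`. -/
lemma satisfiesModulus_closure_singleton {X : Scheme.{u}} {D : X.IdealSheafData} {y : Box X}
    (hy : Box.proj X y ∈ pointsOff D) : SatisfiesModulus D (closure {y}) := by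
  intro x hx
  obtain rfl := hx.eq_of_closure
  -- The ideal of `D` pulls back to the unit ideal, because the normalization maps into the closure
  -- of the point and hence to the complement of `D`.
  refine le_top.trans (top_le_iff.2 ((Scheme.IdealSheafData.support_eq_bot_iff _).1 ?_))
  refine eq_bot_iff.2 fun n hn => ?_
  rw [Scheme.IdealSheafData.support_comap, Scheme.IdealSheafData.support_comap] at hn
  set p := pullback.fst (terminal.from X) (terminal.from P1.{u}) with hp
  set f := (BoxBar X).fromSpecResidueField (toBoxBar X x)
  set φ := normalizationMap (BoxBar X) (toBoxBar X x) with hφ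
  have hn' : p (φ n) ∈ D.support := hn
  have hdense := f.toNormalization.denseRange n
  have h1 : φ n ∈ closure {toBoxBar X x} := by
    refine closure_mono ?_ (image_closure_subset_closure_image φ.continuous ⟨n, hdense, rfl⟩)
    rintro _ ⟨_, ⟨z, rfl⟩, rfl⟩
    rw [hφ, ← Scheme.Hom.comp_apply, Scheme.Hom.toNormalization_fromNormalization,
      Scheme.fromSpecResidueField_apply]
    rfl
  have h2 : toBoxBar X x ⤳ φ n := specializes_iff_mem_closure.2 h1
  have h3 := h2.map p.continuous
  have h4 : toBoxBar X ≫ p = Box.proj X := pullback.lift_fst _ _ _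
  rw [← Scheme.Hom.comp_apply, h4] at h3
  exact Set.disjoint_left.1 hy (specializes_iff_mem_closure.1 h3) hn'

end ChowMod

/-! ### Functions on `X × □¹` as polynomials in `t` -/

namespace ChowMod

noncomputable section

/-- The polynomials in `t` over `Γ(X, U)`, as functions on `U × □¹`. -/
def Box.poly {X : Scheme.{u}} (U : X.Opens) :
    Polynomial Γ(X, U) →+* Γ(Box X, Box.proj X ⁻¹ᵁ U) :=
  Polynomial.eval₂RingHom ((Box.proj X).app U).hom
    ((Box X).presheaf.map (homOfLE le_top).op (Box.t X))

@[simp]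
lemma Box.poly_C {X : Scheme.{u}} (U : X.Opens) (a : Γ(X, U)) :
    Box.poly U (.C a) = (Box.proj X).app U a :=
  Polynomial.eval₂_C _ _

@[simp]
lemma Box.poly_X {X : Scheme.{u}} (U : X.Opens) :
    Box.poly U .X = (Box X).presheaf.map (homOfLE le_top).op (Box.t X) :=
  Polynomial.eval₂_X _ _

lemma appLE_comp_appLE_of_comm {A B B' C : Scheme.{u}} {f : A ⟶ B} {g : B ⟶ C} {f' : A ⟶ B'}
    {g' : B' ⟶ C} (w : f ≫ g = f' ≫ g') {U : C.Opens} {V : B.Opens} {V' : B'.Opens} {W : A.Opens}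
    (e₁ : V ≤ g ⁻¹ᵁ U) (e₂ : W ≤ f ⁻¹ᵁ V) (e₁' : V' ≤ g' ⁻¹ᵁ U) (e₂' : W ≤ f' ⁻¹ᵁ V') :
    g.appLE U V e₁ ≫ f.appLE V W e₂ = g'.appLE U V' e₁' ≫ f'.appLE V' W e₂' := by
  rw [Scheme.Hom.appLE_comp_appLE, Scheme.Hom.appLE_comp_appLE]
  simp_rw [w]

lemma appLE_bijective_of_image_eq {Y Z : Scheme.{u}} (m : Y ⟶ Z) [IsOpenImmersion m] {W : Z.Opens}
    (hW : m ''ᵁ ⊤ = W) (h : ⊤ ≤ m ⁻¹ᵁ W) : Function.Bijective (m.appLE W ⊤ h) := by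
  subst hW
  rw [← Scheme.Hom.appIso_hom']
  exact (m.appIso ⊤).commRingCatIsoToRingEquiv.bijective

/-- The preimage of `U` is the affine line over `U`, by base change along `U ⟶ X`, and for affine
`U` this is the spectrum of the polynomial ring. -/
lemma Box.poly_bijective {X : Scheme.{u}} {U : X.Opens} (hU : IsAffineOpen U) :
    Function.Bijective (Box.poly U) := by
  have : IsAffine U := hU
  set m : Box U.toScheme ⟶ Box X := AffineSpace.map PUnit U.ι with hm
  have hpb : IsPullback m (Box.proj U.toScheme) (Box.proj X) U.ι := AffineSpace.isPullback_map U.ι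
  have : IsOpenImmersion m := MorphismProperty.of_isPullback (P := @IsOpenImmersion) hpb.flip inferInstance
  have hrange : m ''ᵁ ⊤ = Box.proj X ⁻¹ᵁ U := by
    have h := IsOpenImmersion.image_preimage_eq_preimage_image_of_isPullback hpb.flip ⊤
    rw [Scheme.Opens.ι_image_top] at h
    exact h
  have hle : (⊤ : (Box U.toScheme).Opens) ≤ m ⁻¹ᵁ Box.proj X ⁻¹ᵁ U := by
    intro x _
    exact hrange ▸ ⟨x, trivial, rfl⟩
  have he : Function.Bijective (m.appLE _ _ hle) := appLE_bijective_of_image_eq m hrange hle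
  let E : MvPolynomial PUnit.{u + 1} Γ(U.toScheme, ⊤) →+* Γ(Box U.toScheme, ⊤) :=
    MvPolynomial.eval₂Hom ((Box.proj U.toScheme).appTop).hom (AffineSpace.coord U.toScheme)
  have hE : Function.Bijective E := by
    have h := AffineSpace.isoOfIsAffine_hom_appTop (n := PUnit.{u + 1}) U.toScheme
    have h' : IsIso (CommRingCat.ofHom E) := by
      have : CommRingCat.ofHom E = (Scheme.ΓSpecIso _).inv ≫
        (AffineSpace.isoOfIsAffine PUnit.{u + 1} U.toScheme).hom.appTop := by
        rw [h, Iso.inv_hom_id_assoc]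
      rw [this]
      exact IsIso.comp_isIso' inferInstance (inferInstanceAs (IsIso (Scheme.Hom.app _ _)))
    exact (asIso (CommRingCat.ofHom E)).commRingCatIsoToRingEquiv.bijective
  have hle' : (⊤ : U.toScheme.Opens) ≤ U.ι ⁻¹ᵁ U := by simp
  let r : Γ(X, U) ≃+* Γ(U.toScheme, ⊤) := RingEquiv.ofBijective (U.ι.appLE U ⊤ hle').hom
    (appLE_bijective_of_image_eq U.ι U.ι_image_top hle')
  have hcomp : (m.appLE _ _ hle).hom.comp (Box.poly U) =
      E.comp (((MvPolynomial.uniqueAlgEquiv Γ(U.toScheme, ⊤) PUnit.{u + 1}).symm : _ →+* _).comp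
        (Polynomial.mapEquiv r).toRingHom) := by
    refine Polynomial.ringHom_ext' (RingHom.ext fun a => ?_) ?_
    · have h1 := appLE_comp_appLE_of_comm hpb.w (U := U) le_rfl hle hle' (W := ⊤) le_rfl
      rw [Scheme.Hom.appLE_eq_app] at h1
      have h2 : (Box.proj U.toScheme).appTop = (Box.proj U.toScheme).appLE ⊤ ⊤ le_rfl :=
        Scheme.Hom.app_eq_appLE _
      have h3 := congr($h1 a)
      simpa [E, r, h2] using! h3
    · have h1 := AffineSpace.map_appTop_coord (n := PUnit.{u + 1}) U.ι PUnit.unit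
      have h2 : m.appTop = m.appLE ⊤ ⊤ le_rfl := Scheme.Hom.app_eq_appLE _
      have h3 := congr($(m.map_appLE hle (homOfLE le_top).op) (Box.t X))
      rw [← hm, h2] at h1
      have h4 := h3.trans h1
      rw [ConcreteCategory.comp_apply] at h4
      simpa only [RingHom.comp_apply, Box.poly_X, E, r, RingEquiv.toRingHom_eq_coe,
        RingHom.coe_coe, Polynomial.mapEquiv_apply, Polynomial.map_X, MvPolynomial.coe_eval₂Hom,
        MvPolynomial.uniqueAlgEquiv_symm_apply, Polynomial.eval₂_X, MvPolynomial.eval₂_X] using! h4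
  have hb : Function.Bijective ((m.appLE _ _ hle).hom.comp (Box.poly U)) := by
    rw [hcomp]
    exact hE.comp (((MvPolynomial.uniqueAlgEquiv Γ(U.toScheme, ⊤) PUnit.{u + 1}).symm.bijective).comp
      (Polynomial.mapEquiv r).bijective)
  exact (Function.Bijective.of_comp_iff' he _).1 hb

end

end ChowMod

/-! ### Algebra of the local rings of a fibre -/

namespace ChowMod

section Algebra

open Polynomial

lemma length_quotient_comap {R A : Type*} [CommRing R] [CommRing A] (π : R →+* A)
    (hπ : Function.Surjective π) (J : Ideal A) :
    Module.length R (R ⧸ J.comap π) = Module.length A (A ⧸ J) := by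
  let := π.toAlgebra
  rw [← Module.length_eq_of_surjective (S := R) (R := A) (M := A ⧸ J) hπ]
  refine LinearEquiv.length_eq
    (Submodule.quotEquivOfEq _ (LinearMap.ker ((Submodule.mkQ J).restrictScalars R ∘ₗ
      Algebra.linearMap R A)) ?_ ≪≫ₗ LinearMap.quotKerEquivOfSurjective _ ?_)
  · ext r
    simp [RingHom.algebraMap_toAlgebra, Ideal.Quotient.eq_zero_iff_mem]
  · exact (Submodule.mkQ_surjective J).comp hπ

lemma ord_comap {R A : Type*} [CommRing R] [CommRing A] (π : R ≃+* A) (a : R) :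
    Ring.ord R a = Ring.ord A (π a) := by
  rw [Ring.ord, Ring.ord, ← length_quotient_comap (π : R →+* A) π.surjective]
  have h : Ideal.span {a} = (Ideal.span {π a}).comap (π : R →+* A) := by
    ext r
    simp only [Ideal.mem_comap, Ideal.mem_span_singleton, RingHom.coe_coe]
    exact (map_dvd_iff π).symm
  rw [h]

/-- A ring homomorphism every element of whose target is a quotient `ψ n / ψ d`. -/
def IsFractionHom {B R : Type*} [CommRing B] [CommRing R] (ψ : B →+* R) : Prop :=
  (∀ r, ∃ n d, IsUnit (ψ d) ∧ r * ψ d = ψ n) ∧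
    ∀ b, ψ b = 0 → ∃ s, IsUnit (ψ s) ∧ s * b = 0

variable {Γ L R : Type*} [CommRing Γ] [CommRing L] [CommRing R]
  {ρ : Γ →+* L} {ψ : Γ[X] →+* R} {σ : R →+* L} {q : Γ}

lemma IsFractionHom.mem_nonZeroDivisors {B R : Type*} [CommRing B] [CommRing R] {ψ : B →+* R}
    (hψ : IsFractionHom ψ) {z : B} (hz : z ∈ nonZeroDivisors B) : ψ z ∈ nonZeroDivisors R := by
  rw [mem_nonZeroDivisors_iff_right] at hz ⊢
  intro r hr
  obtain ⟨n, d, hd, hrd⟩ := hψ.1 r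
  obtain ⟨s, hs, hsb⟩ := hψ.2 (n * z) (by rw [map_mul, ← hrd, mul_right_comm, hr, zero_mul])
  rw [← mul_assoc] at hsb
  have h1 : ψ (s * n) = 0 := by rw [hz _ hsb, map_zero]
  rw [map_mul, hs.mul_right_eq_zero, ← hrd, hd.mul_left_eq_zero] at h1
  exact h1

/-- The finitely many coefficients of a polynomial have a common denominator. -/
lemma exists_map_eq_C_mul {Γ A : Type*} [CommRing Γ] [CommRing A] (ρ : Γ →+* A)
    (S : Submonoid Γ) (hρ : ∀ r, ∃ n, ∃ d ∈ S, r * ρ d = ρ n) (M : A[X]) :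
    ∃ N : Γ[X], ∃ s ∈ S, N.map ρ = C (ρ s) * M := by
  induction M using Polynomial.induction_on' with
  | add p q hp hq =>
    obtain ⟨N, s, hs, h⟩ := hp
    obtain ⟨N', s', hs', h'⟩ := hq
    refine ⟨C s' * N + C s * N', s * s', mul_mem hs hs', ?_⟩
    simp only [Polynomial.map_add, Polynomial.map_mul, map_C, h, h', map_mul]
    ring
  | monomial n a =>
    obtain ⟨b, d, hd, h⟩ := hρ a
    refine ⟨monomial n b, d, hd, ?_⟩
    rw [map_monomial, ← h, C_mul_monomial, mul_comm]

/-- After clearing denominators this is the factor theorem for `X - q`. The denominators become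
units in `R` because `σ` is local. -/
lemma ker_eq_span_of_section (hρ : IsFractionHom ρ) (hψ : IsFractionHom ψ) [IsLocalHom σ]
    (hσ : ∀ N, σ (ψ N) = ρ (N.eval q)) : RingHom.ker σ = Ideal.span {ψ (X - C q)} := by
  apply le_antisymm
  · intro r hr
    obtain ⟨N, D, hD, hrD⟩ := hψ.1 r
    have h0 : ρ (N.eval q) = 0 := by rw [← hσ, ← hrD, map_mul, (RingHom.mem_ker).1 hr, zero_mul]
    obtain ⟨s, hs, hs0⟩ := hρ.2 _ h0
    have hsu : IsUnit (ψ (C s)) := by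
      refine isUnit_of_map_unit σ _ ?_
      rwa [hσ, eval_C]
    obtain ⟨M, hM⟩ : X - C q ∣ C s * N := by
      rw [dvd_iff_isRoot, IsRoot, eval_mul, eval_C, hs0]
    rw [Ideal.mem_span_singleton]
    have : ψ (X - C q) ∣ r * (ψ D * ψ (C s)) := by
      rw [← mul_assoc, hrD, mul_comm, ← map_mul, hM, map_mul]
      exact dvd_mul_right _ _
    rwa [(hD.mul hsu).dvd_mul_right] at this
  · rw [Ideal.span_singleton_le_iff_mem, RingHom.mem_ker, hσ]
    simp

/-- The length of the local ring of the fibre over `t = q` of the closed subscheme with ideal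
`P`. -/
lemma length_quotient_sup_ker (hρ : IsFractionHom ρ) (hψ : IsFractionHom ψ) [IsLocalHom σ]
    (hσ : ∀ N, σ (ψ N) = ρ (N.eval q)) {K : Type*} [Field K] {p : Ideal L} (φ : L ⧸ p →+* K)
    (g : K) (P : Ideal R)
    (hP : ∀ N : Γ[X], ψ N ∈ P ↔
      N.eval₂ ((φ.comp (Ideal.Quotient.mk p)).comp ρ) g = 0) :
    Module.length R (R ⧸ (P ⊔ RingHom.ker σ)) =
      Module.length (L ⧸ p) ((L ⧸ p) ⧸ fibreIdeal φ g (Ideal.Quotient.mk p (ρ q))) := by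
  set mk := Ideal.Quotient.mk p
  have hunit (s : Γ) (hs : IsUnit (ρ s)) : IsUnit (ψ (C s)) :=
    isUnit_of_map_unit σ _ (by rwa [hσ, eval_C])
  have hsurj : Function.Surjective (mk.comp σ) := by
    refine Ideal.Quotient.mk_surjective.comp fun l => ?_
    obtain ⟨n, d, hd, h⟩ := hρ.1 l
    obtain ⟨e, he⟩ := hunit d hd
    refine ⟨ψ (C n) * e⁻¹.1, hd.mul_right_cancel ?_⟩
    rw [h, map_mul, hσ, eval_C]
    have h1 : ρ d = σ e := by rw [he, hσ, eval_C]
    rw [h1, mul_assoc, ← map_mul, Units.inv_mul, map_one, mul_one]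
  have hev (N : Γ[X]) : (N.map (mk.comp ρ)).eval₂ φ g = N.eval₂ ((φ.comp mk).comp ρ) g := by
    rw [eval₂_map]; rfl
  have hval (N : Γ[X]) : (N.map (mk.comp ρ)).eval (mk (ρ q)) = mk (σ (ψ N)) := by
    rw [hσ, Polynomial.eval_map]; exact eval₂_at_apply (mk.comp ρ) q
  rw [← length_quotient_comap (mk.comp σ) hsurj]
  -- The quotient has the same length over `R` as over its image `L ⧸ p`, so only the ideals in `R`
  -- need comparison.
  suffices P ⊔ RingHom.ker σ = (fibreIdeal φ g (mk (ρ q))).comap (mk.comp σ) by rw [this]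
  apply le_antisymm
  · refine sup_le (fun r hr => ?_) fun r hr => ?_
    · obtain ⟨N, D, hD, hrD⟩ := hψ.1 r
      have hN : ψ N ∈ P := hrD ▸ Ideal.mul_mem_right _ _ hr
      rw [Ideal.mem_comap]
      have h1 : mk.comp σ (r * ψ D) ∈ fibreIdeal φ g (mk (ρ q)) := by
        rw [hrD, mem_fibreIdeal]
        exact ⟨N.map (mk.comp ρ), by rw [hev]; exact (hP N).1 hN, hval N⟩
      rw [map_mul] at h1
      exact (Ideal.mul_unit_mem_iff_mem _ (hD.map (mk.comp σ))).1 h1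
    · rw [Ideal.mem_comap, RingHom.comp_apply, (RingHom.mem_ker).1 hr, map_zero]
      exact zero_mem _
  · intro r hr
    -- Up to a unit, such an `r` agrees modulo `ker σ` with a constant of `Γ`, and that constant
    -- lies in `P`.
    have hker (r : R) (hr : mk (σ r) = 0) : r ∈ P ⊔ RingHom.ker σ := by
      obtain ⟨a, s, hs, h⟩ := hρ.1 (σ r)
      have h1 : ψ (C a) ∈ P := by
        rw [hP, eval₂_C, RingHom.comp_apply, RingHom.comp_apply, ← h, map_mul, hr, zero_mul,
          map_zero]
      have h2 : r * ψ (C s) - ψ (C a) ∈ RingHom.ker σ := by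
        rw [RingHom.mem_ker, map_sub, map_mul, hσ, hσ, eval_C, eval_C, h, sub_self]
      have h3 := add_mem (Ideal.mem_sup_right (S := P) h2) (Ideal.mem_sup_left h1)
      rw [sub_add_cancel] at h3
      exact (Ideal.mul_unit_mem_iff_mem _ (hunit s hs)).1 h3
    obtain ⟨M, hM, hMr⟩ := mem_fibreIdeal.1 (Ideal.mem_comap.1 hr)
    -- The witness `M` has coefficients in `L ⧸ p`; a multiple of it by a unit lifts to `Γ[X]`,
    -- where membership in `P` can be tested.
    obtain ⟨N, s, hs, hN⟩ := exists_map_eq_C_mul (mk.comp ρ) ((IsUnit.submonoid L).comap ρ)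
      (fun l => by
        obtain ⟨l, rfl⟩ := Ideal.Quotient.mk_surjective l
        obtain ⟨n, d, hd, h⟩ := hρ.1 l
        exact ⟨n, d, hd, by rw [RingHom.comp_apply, RingHom.comp_apply, ← h, map_mul]⟩) M
    have hs : IsUnit (ρ s) := hs
    have h1 : ψ N ∈ P := by rw [hP, ← hev, hN, eval₂_mul, hM, mul_zero]
    have h2 : mk (σ (r * ψ (C s) - ψ N)) = 0 := by
      rw [map_sub, map_sub, ← hval N, hN, eval_mul, eval_C, hMr, map_mul, map_mul, hσ, eval_C,
        RingHom.comp_apply, RingHom.comp_apply]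
      ring
    have h3 := add_mem (hker _ h2) (Ideal.mem_sup_left (T := RingHom.ker σ) h1)
    rw [sub_add_cancel] at h3
    exact (Ideal.mul_unit_mem_iff_mem _ (hunit s hs)).1 h3

end Algebra

end ChowMod

/-! ### Graph points: specialization and germs -/

namespace ChowMod

noncomputable section

variable {X : Scheme.{u}}

/-- The point `t = g` of the fibre of `X × □¹` over `w`, as a morphism from `Spec κ(w)`. -/
def graphMap (w : X) (g : X.residueField w) : Spec (X.residueField w) ⟶ Box X :=
  AffineSpace.homOfVector (X.fromSpecResidueField w) fun _ =>
    (Scheme.ΓSpecIso (X.residueField w)).inv g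

/-- The point `t = g` of the fibre of `X × □¹` over `w`. -/
def graphPoint (w : X) (g : X.residueField w) : Box X := graphMap w g default

lemma graphMap_proj (w : X) (g : X.residueField w) :
    graphMap w g ≫ Box.proj X = X.fromSpecResidueField w :=
  AffineSpace.homOfVector_over _ _

@[simp]
lemma proj_graphPoint (w : X) (g : X.residueField w) : Box.proj X (graphPoint w g) = w := by
  rw [graphPoint, ← Scheme.Hom.comp_apply, graphMap_proj, Scheme.fromSpecResidueField_apply]

lemma iota_proj (q : ℤ) : iota X q ≫ Box.proj X = 𝟙 X := AffineSpace.homOfVector_over _ _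

/-- Points of the section are points of constant graphs, so the results on graph points cover both.
-/
lemma iota_apply (q : ℤ) (x : X) : iota X q x = graphPoint x (q : X.residueField x) := by
  have : X.fromSpecResidueField x ≫ iota X q = graphMap x (q : X.residueField x) := by
    rw [iota, AffineSpace.comp_homOfVector, graphMap, Category.comp_id]
    congr 1
    ext
    simp
  rw [graphPoint, ← this, Scheme.Hom.comp_apply, Scheme.fromSpecResidueField_apply]

lemma fromSpecResidueField_appLE_top {w : X} {U : X.Opens} (hw : w ∈ U)
    (h : ⊤ ≤ X.fromSpecResidueField w ⁻¹ᵁ U) :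
    (X.fromSpecResidueField w).appLE U ⊤ h ≫ (Scheme.ΓSpecIso _).hom = X.evaluation U w hw := by
  have h' : ⊤ ≤ Spec.map (X.residue w) ⁻¹ᵁ X.fromSpecStalk w ⁻¹ᵁ U := h
  have h1 : (X.fromSpecResidueField w).appLE U ⊤ h =
      (X.fromSpecStalk w).app U ≫ (Spec.map (X.residue w)).appLE _ ⊤ h' :=
    Scheme.Hom.comp_appLE _ _ _ _ _
  have h2 : (Spec.map (X.residue w)).appTop = (Spec.map (X.residue w)).appLE ⊤ ⊤ le_rfl :=
    Scheme.Hom.app_eq_appLE _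
  rw [h1, Scheme.fromSpecStalk_app hw, Category.assoc, Category.assoc, Category.assoc,
    Scheme.Hom.map_appLE_assoc, ← h2, ← Scheme.ΓSpecIso_inv_naturality_assoc, Iso.inv_hom_id,
    Category.comp_id]
  rfl

lemma graphMap_appLE_poly {w : X} (g : X.residueField w) {U : X.Opens} (hw : w ∈ U)
    (h : ⊤ ≤ graphMap w g ⁻¹ᵁ Box.proj X ⁻¹ᵁ U) (N : Polynomial Γ(X, U)) :
    (Scheme.ΓSpecIso _).hom ((graphMap w g).appLE (Box.proj X ⁻¹ᵁ U) ⊤ h (Box.poly U N)) =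
      N.eval₂ (X.evaluation U w hw).hom g := by
  have h' : ⊤ ≤ X.fromSpecResidueField w ⁻¹ᵁ U := by rwa [← graphMap_proj w g]
  have : ((graphMap w g).appLE (Box.proj X ⁻¹ᵁ U) ⊤ h ≫ (Scheme.ΓSpecIso _).hom).hom.comp
      (Box.poly U) = Polynomial.eval₂RingHom (X.evaluation U w hw).hom g := by
    refine Polynomial.ringHom_ext (fun a => ?_) ?_
    · have h1 : (Box.proj X).app U ≫ (graphMap w g).appLE (Box.proj X ⁻¹ᵁ U) ⊤ h =
          (X.fromSpecResidueField w).appLE U ⊤ h' := by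
        refine (Scheme.Hom.comp_appLE (graphMap w g) (Box.proj X) U ⊤ h).symm.trans ?_
        simp_rw [graphMap_proj]
      have h2 := congr($(fromSpecResidueField_appLE_top hw h') a)
      rw [← h1] at h2
      simpa using! h2
    · have h1 : (graphMap w g).appTop (Box.t X) = (Scheme.ΓSpecIso (X.residueField w)).inv g :=
        AffineSpace.homOfVector_appTop_coord _ _ _
      have h2 : (graphMap w g).appTop = (graphMap w g).appLE ⊤ ⊤ le_rfl :=
        Scheme.Hom.app_eq_appLE _
      have h3 := congr($((graphMap w g).map_appLE h (homOfLE le_top).op) (Box.t X))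
      rw [h2] at h1
      have h5 : (Scheme.ΓSpecIso (X.residueField w)).hom
          ((Scheme.ΓSpecIso (X.residueField w)).inv g) = g := by simp
      have h4 := (congrArg (Scheme.ΓSpecIso (X.residueField w)).hom (h3.trans h1)).trans h5
      rw [ConcreteCategory.comp_apply] at h4
      simpa only [RingHom.comp_apply, Box.poly_X, CommRingCat.hom_comp, Polynomial.coe_eval₂RingHom,
        Polynomial.eval₂_X, CommRingCat.inv_hom_apply] using! h4
  exact congr($this N)

lemma graphPoint_mem_basicOpen_iff {w : X} (g : X.residueField w) {U : X.Opens} (hw : w ∈ U)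
    (N : Polynomial Γ(X, U)) :
    graphPoint w g ∈ (Box X).basicOpen (Box.poly U N) ↔
      N.eval₂ (X.evaluation U w hw).hom g ≠ 0 := by
  have h : ⊤ ≤ graphMap w g ⁻¹ᵁ Box.proj X ⁻¹ᵁ U := by
    intro z _
    change Box.proj X (graphMap w g z) ∈ U
    rwa [Subsingleton.elim z default, ← graphPoint, proj_graphPoint]
  rw [← not_iff_not, not_ne_iff, ← graphMap_appLE_poly g hw h]
  refine (app_eq_zero_iff_notMem_basicOpen (K := X.residueField w) (graphMap w g) _ _).symm.trans ?_
  have hinj : Function.Injective (Scheme.ΓSpecIso (X.residueField w)).hom :=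
    (Scheme.ΓSpecIso (X.residueField w)).commRingCatIsoToRingEquiv.injective
  rw [map_eq_zero_iff _ hinj]
  have hinj' : Function.Injective
      ((Spec (X.residueField w)).presheaf.map (homOfLE h).op) := by
    have : IsIso (homOfLE h) := ⟨homOfLE le_top, rfl, rfl⟩
    exact (asIso ((Spec (X.residueField w)).presheaf.map
      (homOfLE h).op)).commRingCatIsoToRingEquiv.injective
  exact (map_eq_zero_iff _ hinj').symm

/-- Over an affine `U`, the nonvanishing loci of polynomials in `t` form a basis of the topology. -/
lemma graphPoint_specializes_iff {w x : X} (g : X.residueField w) (g' : X.residueField x)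
    {U : X.Opens} (hU : IsAffineOpen U) (hw : w ∈ U) (hx : x ∈ U) :
    graphPoint w g ⤳ graphPoint x g' ↔ ∀ N : Polynomial Γ(X, U),
      N.eval₂ (X.evaluation U w hw).hom g = 0 → N.eval₂ (X.evaluation U x hx).hom g' = 0 := by
  have hW : IsAffineOpen (Box.proj X ⁻¹ᵁ U) := hU.preimage _
  constructor
  · intro h N hN
    by_contra h'
    exact (graphPoint_mem_basicOpen_iff g hw N).1
      (h.mem_open (Opens.isOpen _) ((graphPoint_mem_basicOpen_iff g' hx N).2 h')) hN
  · intro h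
    rw [specializes_iff_forall_open]
    intro O hO hxO
    obtain ⟨s, hs, hxs⟩ := hW.exists_basicOpen_le (V := ⟨O, hO⟩) ⟨graphPoint x g', hxO⟩
      (by change Box.proj X _ ∈ U; rwa [proj_graphPoint])
    obtain ⟨N, rfl⟩ := (Box.poly_bijective hU).2 s
    exact hs ((graphPoint_mem_basicOpen_iff g hw N).2 fun h0 =>
      (graphPoint_mem_basicOpen_iff g' hx N).1 hxs (h N h0))

lemma isFractionHom_germ {Y : Scheme.{u}} {U : Y.Opens} (hU : IsAffineOpen U) {x : Y}
    (hx : x ∈ U) : IsFractionHom (Y.presheaf.germ U x hx).hom := by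
  let := TopCat.Presheaf.algebra_section_stalk Y.presheaf ⟨x, hx⟩
  have := hU.isLocalization_stalk ⟨x, hx⟩
  set M := (hU.primeIdealOf ⟨x, hx⟩).asIdeal.primeCompl
  constructor
  · intro r
    obtain ⟨⟨n, d⟩, h⟩ := IsLocalization.surj M r
    exact ⟨n, d, IsLocalization.map_units (M := M) _ d, h⟩
  · intro b hb
    obtain ⟨c, hc⟩ := (IsLocalization.map_eq_zero_iff M (Y.presheaf.stalk x) b).1 hb
    exact ⟨c, IsLocalization.map_units (M := M) (Y.presheaf.stalk x) c, hc⟩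

/-- The germ at `y` of a polynomial in `t`. -/
def Box.polyGerm {U : X.Opens} {y : Box X} (hy : Box.proj X y ∈ U) :
    Polynomial Γ(X, U) →+* (Box X).presheaf.stalk y :=
  ((Box X).presheaf.germ (Box.proj X ⁻¹ᵁ U) y hy).hom.comp (Box.poly U)

lemma Box.isFractionHom_polyGerm {U : X.Opens} (hU : IsAffineOpen U) {y : Box X}
    (hy : Box.proj X y ∈ U) : IsFractionHom (Box.polyGerm hy) := by
  have h := isFractionHom_germ (hU.preimage (Box.proj X)) (x := y) hy
  have hb := Box.poly_bijective hU
  constructor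
  · intro r
    obtain ⟨n, d, hd, hr⟩ := h.1 r
    obtain ⟨n, rfl⟩ := hb.2 n
    obtain ⟨d, rfl⟩ := hb.2 d
    exact ⟨n, d, hd, hr⟩
  · intro b hb0
    obtain ⟨s, hs, hs0⟩ := h.2 _ hb0
    obtain ⟨s, rfl⟩ := hb.2 s
    exact ⟨s, hs, hb.1 (by rw [map_mul, hs0, map_zero])⟩

lemma Box.stalkSpecializes_polyGerm {U : X.Opens} {y y' : Box X} (h : y' ⤳ y)
    (hy : Box.proj X y ∈ U) (hy' : Box.proj X y' ∈ U) (N : Polynomial Γ(X, U)) :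
    (Box X).presheaf.stalkSpecializes h (Box.polyGerm hy N) = Box.polyGerm hy' N :=
  TopCat.Presheaf.germ_stalkSpecializes_apply _ _ _ _

lemma iota_appLE_poly (q : ℤ) {U : X.Opens} (h : U ≤ iota X q ⁻¹ᵁ Box.proj X ⁻¹ᵁ U)
    (N : Polynomial Γ(X, U)) :
    (iota X q).appLE (Box.proj X ⁻¹ᵁ U) U h (Box.poly U N) = N.eval (q : Γ(X, U)) := by
  have : ((iota X q).appLE (Box.proj X ⁻¹ᵁ U) U h).hom.comp (Box.poly U) =
      Polynomial.evalRingHom (q : Γ(X, U)) := by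
    refine Polynomial.ringHom_ext (fun a => ?_) ?_
    · have h1 : (Box.proj X).app U ≫ (iota X q).appLE (Box.proj X ⁻¹ᵁ U) U h = 𝟙 _ := by
        refine (Scheme.Hom.comp_appLE (iota X q) (Box.proj X) U U h).symm.trans ?_
        simp_rw [iota_proj]
        exact (Category.id_comp _).trans (X.presheaf.map_id _)
      simpa using! congr($h1 a)
    · have h1 : (iota X q).appTop (Box.t X) = (q : Γ(X, ⊤)) :=
        AffineSpace.homOfVector_appTop_coord _ _ _
      have h2 : (iota X q).appTop = (iota X q).appLE ⊤ ⊤ le_rfl :=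
        Scheme.Hom.app_eq_appLE _
      have h3 := congr($((iota X q).map_appLE h (homOfLE le_top).op) (Box.t X))
      have h4 := congr($((iota X q).appLE_map (le_refl ⊤) (homOfLE (le_top : U ≤ ⊤)).op) (Box.t X))
      rw [h2] at h1
      rw [ConcreteCategory.comp_apply] at h3 h4
      erw [h1] at h4
      rw [map_intCast] at h4
      simpa only [RingHom.comp_apply, Box.poly_X, Polynomial.coe_evalRingHom,
        Polynomial.eval_X] using! h3.trans h4.symm
  exact congr($this N)

lemma iota_stalkMap_polyGerm (q : ℤ) {U : X.Opens} {x : X} (hx : x ∈ U)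
    (hx' : Box.proj X (iota X q x) ∈ U) (N : Polynomial Γ(X, U)) :
    (iota X q).stalkMap x (Box.polyGerm hx' N) = X.presheaf.germ U x hx (N.eval (q : Γ(X, U))) := by
  have h : U ≤ iota X q ⁻¹ᵁ Box.proj X ⁻¹ᵁ U := fun y hy => by
    change Box.proj X (iota X q y) ∈ U
    rwa [proj_iota]
  rw [← iota_appLE_poly q h]
  refine (Scheme.Hom.germ_stalkMap_apply (iota X q) _ x hx' _).trans ?_
  exact (TopCat.Presheaf.germ_res_apply X.presheaf (homOfLE h) x hx _).symm

end

end ChowMod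

/-! ### Codimension of graph points -/

namespace ChowMod

variable {X : Scheme.{u}}

-- Over the localization `L` the two kernels are maximal ideals of `L` and `L[X]`, one lying over
-- the other. In the noetherian case the height grows by one in `L[X]`, and localization preserves
-- heights.
attribute [local instance] Polynomial.algebra Polynomial.isLocalization in
lemma height_ker_eval₂RingHom {A L K : Type*} [CommRing A] [IsNoetherianRing A] [CommRing L]
    [Algebra A L] (S : Submonoid A) [IsLocalization S L] [Field K] {π : L →+* K}
    (hπ : Function.Surjective π) (g : K) :
    (RingHom.ker (Polynomial.eval₂RingHom (π.comp (algebraMap A L)) g)).height =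
      (RingHom.ker (π.comp (algebraMap A L))).height + 1 := by
  have := IsLocalization.isNoetherianRing S L inferInstance
  set Q := RingHom.ker (Polynomial.eval₂RingHom π g)
  have hsurj : Function.Surjective (Polynomial.eval₂RingHom π g) := fun k => by
    obtain ⟨l, rfl⟩ := hπ k
    exact ⟨Polynomial.C l, by simp⟩
  have : Q.IsMaximal := RingHom.ker_isMaximal_of_surjective _ hsurj
  have : Q.LiesOver (RingHom.ker π) := ⟨by ext; simp [Q, Ideal.under]⟩
  have h1 := Polynomial.height_eq_height_add_one (RingHom.ker π) Q
  rw [← IsLocalization.height_under S (RingHom.ker π), ← IsLocalization.height_under (S.map Polynomial.C) Q] at h1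
  convert h1 using 2
  · ext N
    simp [Q, Ideal.under, Polynomial.eval₂_map]
  · rfl

lemma height_ker_evaluation {Y : Scheme.{u}} {V : Y.Opens} (hV : IsAffineOpen V) {y : Y}
    (hy : y ∈ V) : (RingHom.ker (Y.evaluation V y hy).hom).height = Order.coheight y := by
  let := TopCat.Presheaf.algebra_section_stalk Y.presheaf ⟨y, hy⟩
  have := hV.isLocalization_stalk ⟨y, hy⟩
  have h1 := ringKrullDim_stalk_eq_coheight y
  rw [← IsLocalRing.maximalIdeal_height_eq_ringKrullDim] at h1
  have h2 := IsLocalization.height_under (hV.primeIdealOf ⟨y, hy⟩).asIdeal.primeCompl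
    (IsLocalRing.maximalIdeal (Y.presheaf.stalk y))
  rw [← WithBot.coe_inj.1 h1, ← h2]
  congr 1
  ext s
  exact IsLocalRing.residue_eq_zero_iff _

lemma coheight_graphPoint [IsNoetherian X] (w : X) (g : X.residueField w) :
    Order.coheight (graphPoint w g) = Order.coheight w + 1 := by
  obtain ⟨U, hU, hw, -⟩ := X.isBasis_affineOpens.exists_subset_of_mem_open
    (Set.mem_univ w) isOpen_univ
  obtain ⟨U, hU : IsAffineOpen U, rfl⟩ := hU
  have hw : w ∈ U := hw
  have hw' : graphPoint w g ∈ Box.proj X ⁻¹ᵁ U := by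
    change Box.proj X _ ∈ U
    rwa [proj_graphPoint]
  let := TopCat.Presheaf.algebra_section_stalk X.presheaf ⟨w, hw⟩
  have := hU.isLocalization_stalk ⟨w, hw⟩
  have : IsNoetherianRing Γ(X, U) := IsLocallyNoetherian.component_noetherian ⟨U, hU⟩
  have h := height_ker_eval₂RingHom (A := Γ(X, U)) (hU.primeIdealOf ⟨w, hw⟩).asIdeal.primeCompl
    (π := (X.residue w).hom) (IsLocalRing.residue_surjective) g
  rw [← height_ker_evaluation hU hw, ← height_ker_evaluation (hU.preimage (Box.proj X)) hw',
    ← RingEquiv.height_comap (.ofBijective (Box.poly U) (Box.poly_bijective hU))]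
  refine Eq.trans ?_ h
  congr 1
  ext N
  exact (not_iff_not.1 ((Scheme.evaluation_ne_zero_iff_mem_basicOpen _ _ hw' _).trans
    (graphPoint_mem_basicOpen_iff g hw N)))

end ChowMod

/-! ### Local rings of closures and multiplicities of fibres -/

namespace ChowMod

variable {X : Scheme.{u}}

instance primeOf_isPrime {w x : X} (h : w ⤳ x) : (primeOf h).IsPrime :=
  Ideal.comap_isPrime _ _

lemma toResidueField_injective {w x : X} (h : w ⤳ x) :
    Function.Injective (toResidueField h) :=
  RingHom.lift_injective_of_ker_le_ideal _ _ fun a ha => by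
    exact (IsLocalRing.residue_eq_zero_iff _).1 ha

lemma toResidueField_germ {w x : X} (h : w ⤳ x) {U : X.Opens} (hw : w ∈ U) (hx : x ∈ U)
    (a : Γ(X, U)) :
    toResidueField h (Ideal.Quotient.mk _ (X.presheaf.germ U x hx a)) =
      X.evaluation U w hw a :=
  congrArg (X.residue w) (TopCat.Presheaf.germ_stalkSpecializes_apply X.presheaf hx h a)

lemma height_primeOf {w x : X} (h : w ⤳ x) : (primeOf h).height = Order.coheight w := by
  obtain ⟨U, hU, hx, -⟩ := X.isBasis_affineOpens.exists_subset_of_mem_open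
    (Set.mem_univ x) isOpen_univ
  obtain ⟨U, hU : IsAffineOpen U, rfl⟩ := hU
  have hx : x ∈ U := hx
  have hw : w ∈ U := h.mem_open U.isOpen hx
  let := TopCat.Presheaf.algebra_section_stalk X.presheaf ⟨x, hx⟩
  have := hU.isLocalization_stalk ⟨x, hx⟩
  rw [← height_ker_evaluation hU hw,
    ← IsLocalization.height_under (hU.primeIdealOf ⟨x, hx⟩).asIdeal.primeCompl (primeOf h)]
  congr 1
  ext a
  have h1 := TopCat.Presheaf.germ_stalkSpecializes_apply X.presheaf hx h a
  change X.presheaf.stalkSpecializes h (X.presheaf.germ U x hx a) ∈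
    IsLocalRing.maximalIdeal (X.presheaf.stalk w) ↔ _
  rw [h1]
  exact (IsLocalRing.residue_eq_zero_iff _).symm

/-- A prime strictly between that of `w` and the maximal ideal would have height strictly between
`n` and `n + 1`. -/
lemma krullDimLE_localRingAt [IsNoetherian X] {w x : X} (h : w ⤳ x) {n : ℕ} (hw : Order.coheight w = n)
    (hx : Order.coheight x = n + 1) : Ring.KrullDimLE 1 (LocalRingAt h) := by
  rw [Ring.krullDimLE_one_iff_of_noZeroDivisors]
  intro I hI hI'
  set J := I.comap (Ideal.Quotient.mk (primeOf h)) with hJ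
  have hlt : primeOf h < J := by
    refine lt_of_le_of_ne (fun a ha => ?_) fun heq => hI ?_
    · rw [hJ, Ideal.mem_comap, Ideal.Quotient.eq_zero_iff_mem.2 ha]
      exact I.zero_mem
    · rw [← Ideal.map_comap_of_surjective _ Ideal.Quotient.mk_surjective I, ← hJ, ← heq,
        Ideal.map_quotient_self]
  have hmax : J = IsLocalRing.maximalIdeal (X.presheaf.stalk x) := by
    by_contra hne
    have h2 : J < IsLocalRing.maximalIdeal (X.presheaf.stalk x) :=
      lt_of_le_of_ne (IsLocalRing.le_maximalIdeal Ideal.IsPrime.ne_top') hne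
    have h3 := Ideal.height_strict_mono_of_isPrime hlt
    have h4 := Ideal.height_strict_mono_of_isPrime h2
    have h5 := ringKrullDim_stalk_eq_coheight x
    rw [← IsLocalRing.maximalIdeal_height_eq_ringKrullDim, WithBot.coe_inj] at h5
    rw [height_primeOf, hw] at h3
    rw [h5, hx] at h4
    exact (Order.add_one_le_of_lt h3).not_gt h4
  have hJm : J.IsMaximal := hmax ▸ inferInstance
  rw [← Ideal.map_comap_of_surjective _ Ideal.Quotient.mk_surjective I]
  exact (Ideal.map_eq_top_or_isMaximal_of_surjective _ Ideal.Quotient.mk_surjective hJm).resolve_left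
    fun htop => hI'.ne_top (by
      rwa [Ideal.map_comap_of_surjective _ Ideal.Quotient.mk_surjective I] at htop)

lemma polyGerm_mem_primeOf_iff {w x : X} (h : w ⤳ x) {g : X.residueField w} {y : Box X}
    (hy : graphPoint w g ⤳ y) {U : X.Opens} (hw : w ∈ U) (hx : x ∈ U) (hyU : Box.proj X y ∈ U)
    (N : Polynomial Γ(X, U)) :
    Box.polyGerm hyU N ∈ primeOf hy ↔
      N.eval₂ (((toResidueField h).comp (Ideal.Quotient.mk (primeOf h))).comp
        (X.presheaf.germ U x hx).hom) g = 0 := by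
  have hφ : ((toResidueField h).comp (Ideal.Quotient.mk (primeOf h))).comp
      (X.presheaf.germ U x hx).hom = (X.evaluation U w hw).hom :=
    RingHom.ext fun a => toResidueField_germ h hw hx a
  have hwU : Box.proj X (graphPoint w g) ∈ U := by rwa [proj_graphPoint]
  rw [hφ, ← not_iff_not, ← ne_eq, ← graphPoint_mem_basicOpen_iff g hw N,
    (Box X).mem_basicOpen (Box.poly U N) (graphPoint w g) hwU]
  have h1 := Box.stalkSpecializes_polyGerm hy hyU hwU N
  change ¬ (Box X).presheaf.stalkSpecializes hy (Box.polyGerm hyU N) ∈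
    IsLocalRing.maximalIdeal ((Box X).presheaf.stalk (graphPoint w g)) ↔ _
  rw [h1, IsLocalRing.mem_maximalIdeal, mem_nonunits_iff, not_not]
  rfl

/-- The local multiplicity of the fibre `t = q` of the graph of `g`. -/
lemma length_primeOf_sup_ker {w x : X} (h : w ⤳ x) (g : X.residueField w) (q : ℤ)
    (hx : graphPoint w g ⤳ iota X q x) :
    Module.length ((Box X).presheaf.stalk (iota X q x))
      ((Box X).presheaf.stalk (iota X q x) ⧸
        (primeOf hx ⊔ RingHom.ker ((iota X q).stalkMap x).hom)) =
      Module.length (LocalRingAt h) (LocalRingAt h ⧸ fibreIdeal (toResidueField h) g q) := by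
  obtain ⟨U, hU, hxU, -⟩ := X.isBasis_affineOpens.exists_subset_of_mem_open
    (Set.mem_univ x) isOpen_univ
  obtain ⟨U, hU : IsAffineOpen U, rfl⟩ := hU
  have hxU : x ∈ U := hxU
  have hwU : w ∈ U := h.mem_open U.isOpen hxU
  have hxU' : Box.proj X (iota X q x) ∈ U := by rwa [proj_iota]
  have := length_quotient_sup_ker (σ := ((iota X q).stalkMap x).hom) (q := (q : Γ(X, U)))
    (isFractionHom_germ hU hxU) (Box.isFractionHom_polyGerm hU hxU')
    (iota_stalkMap_polyGerm q hxU hxU') (toResidueField h) g (primeOf hx)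
    (polyGerm_mem_primeOf_iff h hx hwU hxU hxU')
  rw [this, map_intCast, map_intCast]

/-- Some polynomial vanishes on the graph but is a unit at the point over `x`. Hence the length
formula also holds, with value zero, off the fibre. -/
lemma fibreIdeal_eq_top {w x : X} (h : w ⤳ x) (g : X.residueField w) (q : ℤ)
    (hx : ¬ graphPoint w g ⤳ iota X q x) :
    fibreIdeal (toResidueField h) g (q : LocalRingAt h) = ⊤ := by
  obtain ⟨U, hU, hxU, -⟩ := X.isBasis_affineOpens.exists_subset_of_mem_open
    (Set.mem_univ x) isOpen_univ
  obtain ⟨U, hU : IsAffineOpen U, rfl⟩ := hU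
  have hxU : x ∈ U := hxU
  have hwU : w ∈ U := h.mem_open U.isOpen hxU
  rw [iota_apply, graphPoint_specializes_iff g _ hU hwU hxU] at hx
  push Not at hx
  obtain ⟨N, hN, hN'⟩ := hx
  set ρ : Γ(X, U) →+* LocalRingAt h :=
    (Ideal.Quotient.mk (primeOf h)).comp (X.presheaf.germ U x hxU).hom
  have hφ : (toResidueField h).comp ρ = (X.evaluation U w hwU).hom :=
    RingHom.ext fun a => toResidueField_germ h hwU hxU a
  refine Ideal.eq_top_of_isUnit_mem _ (mem_fibreIdeal.2 ⟨N.map ρ, ?_, rfl⟩) ?_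
  · rwa [Polynomial.eval₂_map, hφ]
  · have h1 : (N.map ρ).eval (q : LocalRingAt h) = ρ (N.eval (q : Γ(X, U))) := by
      rw [← map_intCast ρ, Polynomial.eval_map, Polynomial.eval₂_at_apply]
    rw [h1]
    have h2 : (X.evaluation U x hxU) (N.eval (q : Γ(X, U))) ≠ 0 := by
      rw [← map_intCast (X.evaluation U x hxU).hom, Polynomial.eval₂_at_apply] at hN'
      exact hN'
    refine IsUnit.map (Ideal.Quotient.mk (primeOf h)) ?_
    have h3 := (Scheme.evaluation_ne_zero_iff_mem_basicOpen _ _ hxU _).1 h2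
    exact (Scheme.mem_basicOpen _ _ _ hxU).1 h3

end ChowMod

/-! ### The divisor of a function as a difference of fibres -/

namespace ChowMod

variable {X : Scheme.{u}}

lemma specializes_of_graphPoint_specializes {w x : X} {g : X.residueField w} {q : ℤ}
    (h : graphPoint w g ⤳ iota X q x) : w ⤳ x := by
  have := h.map (Box.proj X).continuous
  rwa [proj_graphPoint, proj_iota] at this

lemma eq_of_specializes_of_coheight {Y : Scheme.{u}} {y z : Y} {n : ℕ} (h : y ⤳ z)
    (hy : (n : ℕ∞) ≤ Order.coheight y) (hz : Order.coheight z = n) : y = z := by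
  by_contra hne
  have hlt : z < y := lt_of_le_not_ge (show z ≤ y from h) fun h' : z ⤳ y => hne (h.antisymm h').eq
  have := Order.coheight_strictAnti hlt
    ((Order.coheight_anti hlt.le).trans_lt (hz ▸ ENat.natCast_lt_top n))
  exact (hz ▸ this).not_ge hy

lemma eq_or_eq_of_specializes {Y : Scheme.{u}} {w y x : Y} (hwy : w ⤳ y) (hyx : y ⤳ x) {n : ℕ}
    (hw : Order.coheight w = n) (hx : Order.coheight x = (n : ℕ∞) + 1) : y = w ∨ y = x := by
  by_cases hy : Order.coheight y ≤ n
  · refine .inl (eq_of_specializes_of_coheight (n := n) hwy hw.ge (le_antisymm hy ?_)).symm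
    rw [← hw]
    exact Order.coheight_anti (show y ≤ w from hwy)
  · refine .inr (eq_of_specializes_of_coheight (n := n + 1) hyx ?_ (by rw [hx]; norm_cast))
    exact_mod_cast Order.add_one_le_of_lt (not_le.1 hy)

lemma graphPoint_mem_pointsOfCodim [IsNoetherian X] {p : ℤ} {w : X}
    (hw : w ∈ pointsOfCodim X (p - 1)) (g : X.residueField w) :
    graphPoint w g ∈ pointsOfCodim (Box X) p := by
  obtain ⟨n, hn, hw⟩ := hw
  exact ⟨n + 1, by push_cast; omega, by rw [coheight_graphPoint, hw]; norm_cast⟩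

lemma mem_pointsOfCodim_of_iota [IsNoetherian X] {p q : ℤ} {w : X}
    (hw : iota X q w ∈ pointsOfCodim (Box X) p) : w ∈ pointsOfCodim X (p - 1) := by
  obtain ⟨n, hn, hw⟩ := hw
  rw [iota_apply, coheight_graphPoint] at hw
  obtain _ | n := n
  · simp at hw
  · refine ⟨n, by push_cast at hn; omega, ?_⟩
    push_cast at hw
    exact (ENat.add_left_injective_of_ne_top ENat.one_ne_top) hw

lemma exists_coheight_eq {p : ℤ} {w x : X} (hw : w ∈ pointsOfCodim X (p - 1))
    (hx : x ∈ pointsOfCodim X p) :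
    ∃ n : ℕ, Order.coheight w = n ∧ Order.coheight x = n + 1 := by
  obtain ⟨n, hn, hw⟩ := hw
  obtain ⟨m, hm, hx⟩ := hx
  obtain rfl : m = n + 1 := by omega
  exact ⟨n, hw, by rw [hx]; norm_cast⟩

/-- If `g = a / s` in `κ(w)`, the linear polynomial `s t - a` vanishes at the graph point of `g`
only. -/
lemma graphPoint_injective (w : X) : Function.Injective (graphPoint w) := by
  intro g g' h
  obtain ⟨U, hU, hw, -⟩ := X.isBasis_affineOpens.exists_subset_of_mem_open
    (Set.mem_univ w) isOpen_univ
  obtain ⟨U, hU : IsAffineOpen U, rfl⟩ := hU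
  have hw : w ∈ U := hw
  have hsurj (k : X.residueField w) : ∃ a s : Γ(X, U), X.evaluation U w hw s ≠ 0 ∧
      k * X.evaluation U w hw s = X.evaluation U w hw a := by
    obtain ⟨r, rfl⟩ := X.residue_surjective w k
    obtain ⟨a, s, hs, h⟩ := (isFractionHom_germ hU hw).1 r
    refine ⟨a, s, (hs.map (X.residue w).hom).ne_zero, ?_⟩
    exact (map_mul (X.residue w).hom _ _).symm.trans (congrArg (X.residue w) h)
  obtain ⟨a, s, hs, hg⟩ := hsurj g
  have := (graphPoint_specializes_iff g g' hU hw hw).1 (specializes_of_eq h)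
    (Polynomial.X * Polynomial.C s - Polynomial.C a) (by
      simp only [Polynomial.eval₂_sub, Polynomial.eval₂_mul, Polynomial.eval₂_X,
        Polynomial.eval₂_C]
      exact sub_eq_zero.2 hg)
  simp only [Polynomial.eval₂_sub, Polynomial.eval₂_mul, Polynomial.eval₂_X,
        Polynomial.eval₂_C] at this
  exact mul_right_cancel₀ hs (hg.trans (sub_eq_zero.1 this).symm)

lemma graphPoint_notMem_range_iota {w : X} {g : X.residueField w} {q : ℤ}
    (hg : g ≠ q) : graphPoint w g ∉ Set.range (iota X q) := by
  rintro ⟨y, hy⟩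
  have := congrArg (Box.proj X) hy
  rw [proj_graphPoint, proj_iota] at this
  subst this
  rw [iota_apply] at hy
  exact hg (graphPoint_injective y hy).symm

/-- A point of the fibre above `x` is `x` or `w`, as their codimensions differ by one. In the second
case the graph point and `ι_q w` have equal codimension, so they coincide, which `g ≠ q` excludes.
-/
lemma isGenericIn_preClosure_graphPoint [IsNoetherian X] {p : ℤ} {w x : X}
    (hw : w ∈ pointsOfCodim X (p - 1)) (hx : x ∈ pointsOfCodim X p) {g : X.residueField w} {q : ℤ}
    (hg : g ≠ q) (h : graphPoint w g ⤳ iota X q x) :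
    IsGenericIn (preClosure (iota X q) (graphPoint w g) : Set X) x := by
  refine ⟨specializes_iff_mem_closure.1 h, fun y hy hyx => ?_⟩
  obtain ⟨n, hn, hn'⟩ := exists_coheight_eq hw hx
  have hy : graphPoint w g ⤳ iota X q y := specializes_iff_mem_closure.2 hy
  refine (eq_or_eq_of_specializes (specializes_of_graphPoint_specializes hy) hyx hn hn').resolve_left
    fun hyw => graphPoint_notMem_range_iota hg ⟨y, ?_⟩
  refine (eq_of_specializes_of_coheight (n := n + 1) hy ?_ ?_).symm
  · rw [coheight_graphPoint, hn]; norm_cast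
  · rw [iota_apply, coheight_graphPoint, hyw, hn]; norm_cast

lemma incl_intersectionCycle_graphPoint [IsNoetherian X] {p : ℤ} {w : X}
    (hw : w ∈ pointsOfCodim X (p - 1)) {g : X.residueField w} {q : ℤ} (hg : g ≠ q) {S : Set X}
    (hS : (preClosure (iota X q) (graphPoint w g) : Set X) ⊆ S)
    (x : {x : X // x ∈ pointsOfCodim X p ∧ x ∈ S}) (h : w ⤳ x.1) :
    Cycles.incl p hS (intersectionCycle (iota X q) p (graphPoint w g)) x =
      (Module.length (LocalRingAt h)
        (LocalRingAt h ⧸ fibreIdeal (toResidueField h) g (q : LocalRingAt h))).toNat := by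
  by_cases hx : x.1 ∈ (preClosure (iota X q) (graphPoint w g) : Set X)
  · have hx' : graphPoint w g ⤳ iota X q x := specializes_iff_mem_closure.2 hx
    rw [Cycles.incl_apply p hS _ x hx, ← length_primeOf_sup_ker h g q hx']
    exact dif_pos (isGenericIn_preClosure_graphPoint hw x.2.1 hg hx')
  · have hx' : ¬ graphPoint w g ⤳ iota X q x := fun h => hx (specializes_iff_mem_closure.1 h)
    rw [Cycles.incl_apply_of_notMem p hS _ x hx, fibreIdeal_eq_top h g q hx']
    simp

lemma incl_intersectionCycle_graphPoint_of_not_specializes [IsNoetherian X] {p q : ℤ} {w : X}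
    {g : X.residueField w} {S : Set X}
    (hS : (preClosure (iota X q) (graphPoint w g) : Set X) ⊆ S)
    (x : {x : X // x ∈ pointsOfCodim X p ∧ x ∈ S}) (h : ¬ w ⤳ x.1) :
    Cycles.incl p hS (intersectionCycle (iota X q) p (graphPoint w g)) x = 0 :=
  Cycles.incl_apply_of_notMem p hS _ x fun hx =>
    h (specializes_of_graphPoint_specializes (specializes_iff_mem_closure.2 hx))

instance [IsNoetherian X] {w x : X} (h : w ⤳ x) : IsNoetherianRing (LocalRingAt h) :=
  inferInstanceAs (IsNoetherianRing (X.presheaf.stalk x ⧸ primeOf h))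

/-- The divisor of `f` is the difference of the fibres over `t = 0` and `t = 1` of the graph of
`f / (f - 1)`. -/
lemma isDiv_apply_eq_sub [IsNoetherian X] {p : ℤ} {S S' : Set X} {w : X}
    (hw : w ∈ pointsOfCodim X (p - 1)) {f : (X.residueField w)ˣ} (hf : (f : X.residueField w) ≠ 1)
    {z : Cycles X p S} (hz : IsDiv w f z) (hS : S ⊆ S') (hwS : closure {w} ⊆ S)
    (h₀ : (preClosure (iota X 0) (graphPoint w (f / (f - 1) : X.residueField w)) : Set X) ⊆ S')
    (h₁ : (preClosure (iota X 1) (graphPoint w (f / (f - 1) : X.residueField w)) : Set X) ⊆ S') :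
    Cycles.incl p hS z =
      Cycles.incl p h₀ (intersectionCycle (iota X 0) p (graphPoint w (f / (f - 1)))) -
      Cycles.incl p h₁ (intersectionCycle (iota X 1) p (graphPoint w (f / (f - 1)))) := by
  set g : X.residueField w := f / (f - 1) with hg
  have hf' : (f : X.residueField w) - 1 ≠ 0 := sub_ne_zero.2 hf
  have hgf : g * (f - 1) = f := div_mul_cancel₀ _ hf'
  have hg₀ : g ≠ (0 : ℤ) := by
    rw [Int.cast_zero]
    exact div_ne_zero f.ne_zero hf'
  have hg₁ : g ≠ (1 : ℤ) := by
    rw [Int.cast_one]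
    intro h
    rw [h, one_mul, sub_eq_self] at hgf
    exact one_ne_zero hgf
  ext x
  rw [Finsupp.sub_apply]
  by_cases h : w ⤳ x.1
  · have hxS : x.1 ∈ S := hwS (specializes_iff_mem_closure.1 h)
    rw [Cycles.incl_apply p hS _ x hxS, incl_intersectionCycle_graphPoint hw hg₀ h₀ x h,
      incl_intersectionCycle_graphPoint hw hg₁ h₁ x h]
    obtain ⟨n, hn, hn'⟩ := exists_coheight_eq hw x.2.1
    have := krullDimLE_localRingAt h hn hn'
    obtain ⟨a, b, ha, hb, hab, hz⟩ := (hz ⟨x.1, x.2.1, hxS⟩).1 h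
    have hφb : toResidueField h b ≠ 0 := (map_ne_zero_iff _ (toResidueField_injective h)).2 hb
    rw [hz, Int.cast_zero, Int.cast_one]
    refine (length_fibreIdeal_sub (toResidueField_injective h) ha hb ?_ ?_).symm
    · rintro rfl
      exact hf (mul_right_cancel₀ hφb (hab.trans (one_mul _).symm))
    -- With `f = a / b`, the equation `g (f - 1) = f` becomes `g (a - b) = a`.
    · rw [← hab, ← sub_one_mul, ← mul_assoc, hgf]
  · rw [incl_intersectionCycle_graphPoint_of_not_specializes h₀ x h,
      incl_intersectionCycle_graphPoint_of_not_specializes h₁ x h, sub_zero]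
    by_cases hxS : x.1 ∈ S
    · rw [Cycles.incl_apply p hS _ x hxS]
      exact (hz ⟨x.1, x.2.1, hxS⟩).2 h
    · exact Cycles.incl_apply_of_notMem p hS _ x hxS

end ChowMod

/-! ### Subsets contained in a fibre contribute zero -/

namespace ChowMod

variable {X : Scheme.{u}}

lemma exists_isUnit_mul_eq_of_span_eq {R : Type*} [CommRing R] {e g : R}
    (he : e ∈ nonZeroDivisors R) (h : Ideal.span {g} = Ideal.span {e}) :
    ∃ c, IsUnit c ∧ g = c * e := by
  obtain ⟨c, rfl⟩ := Ideal.mem_span_singleton'.1 (h ▸ Ideal.mem_span_singleton_self g)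
  obtain ⟨d, hd⟩ := Ideal.mem_span_singleton'.1 (h ▸ Ideal.mem_span_singleton_self e)
  refine ⟨c, .of_mul_eq_one_right d (sub_eq_zero.1 ?_), rfl⟩
  refine (mem_nonZeroDivisors_iff_right.1 he) _ ?_
  rw [sub_mul, mul_assoc, hd, one_mul, sub_self]

lemma Box.polyGerm_X_sub_C {q : ℤ} {U : X.Opens} {y : Box X} (hy : Box.proj X y ∈ U) :
    Box.polyGerm hy (.X - .C (q : Γ(X, U))) =
      (Box X).presheaf.germ ⊤ y trivial (Box.t X - (q : Γ(Box X, ⊤))) := by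
  rw [Box.polyGerm, RingHom.comp_apply, map_sub, map_sub, map_sub]
  congr 1
  · rw [Box.poly_X]
    exact TopCat.Presheaf.germ_res_apply _ _ _ _ _
  · simp

/-- The local equations are germs of one global function, which makes the normal bundle trivial. -/
lemma ker_stalkMap_iota (q : ℤ) (x : X) : RingHom.ker ((iota X q).stalkMap x).hom =
    Ideal.span {(Box X).presheaf.germ ⊤ (iota X q x) trivial (Box.t X - (q : Γ(Box X, ⊤)))} := by
  obtain ⟨U, hU, hx, -⟩ := X.isBasis_affineOpens.exists_subset_of_mem_open
    (Set.mem_univ x) isOpen_univ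
  obtain ⟨U, hU : IsAffineOpen U, rfl⟩ := hU
  have hx : x ∈ U := hx
  have hx' : Box.proj X (iota X q x) ∈ U := by rwa [proj_iota]
  rw [← Box.polyGerm_X_sub_C hx']
  exact ker_eq_span_of_section (isFractionHom_germ hU hx) (Box.isFractionHom_polyGerm hU hx')
    (iota_stalkMap_polyGerm q hx hx')

lemma germ_t_sub_mem_nonZeroDivisors (q : ℤ) (y : Box X) :
    (Box X).presheaf.germ ⊤ y trivial (Box.t X - (q : Γ(Box X, ⊤))) ∈
      nonZeroDivisors ((Box X).presheaf.stalk y) := by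
  obtain ⟨U, hU, hy, -⟩ := X.isBasis_affineOpens.exists_subset_of_mem_open
    (Set.mem_univ (Box.proj X y)) isOpen_univ
  obtain ⟨U, hU : IsAffineOpen U, rfl⟩ := hU
  have hy : Box.proj X y ∈ U := hy
  rw [← Box.polyGerm_X_sub_C hy]
  exact (Box.isFractionHom_polyGerm hU hy).mem_nonZeroDivisors
    (Polynomial.monic_X_sub_C _).mem_nonZeroDivisors

instance (q : ℤ) : IsClosedImmersion (iota X q) := by
  have : IsClosedImmersion (iota X q ≫ Box.proj X) := by
    rw [iota_proj]
    infer_instance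
  exact .of_comp (iota X q) (Box.proj X)

section

variable {P : Scheme.{u}} (i : X ⟶ P) {w x : X}

lemma comap_stalkMap_primeOf (h : w ⤳ x) (h' : i w ⤳ i x) :
    (primeOf h).comap (i.stalkMap x).hom = primeOf h' := by
  ext r
  have h1 := Scheme.Hom.stalkSpecializes_stalkMap_apply i w x h r
  change X.presheaf.stalkSpecializes h (i.stalkMap x r) ∈
    IsLocalRing.maximalIdeal (X.presheaf.stalk w) ↔ P.presheaf.stalkSpecializes h' r ∈
    IsLocalRing.maximalIdeal (P.presheaf.stalk (i w))
  rw [← h1]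
  exact (map_mem_nonunits_iff (i.stalkMap w).hom _)

lemma residueFieldMap_toResidueField (h : w ⤳ x) (h' : i w ⤳ i x) (a : LocalRingAt h') :
    i.residueFieldMap w (toResidueField h' a) = toResidueField h
      (Ideal.quotientMap (primeOf h) (i.stalkMap x).hom (comap_stalkMap_primeOf i h h').ge a) := by
  obtain ⟨r, rfl⟩ := Ideal.Quotient.mk_surjective a
  rw [Ideal.quotientMap_mk]
  have h1 := congr($(Scheme.residue_residueFieldMap i w) (P.presheaf.stalkSpecializes h' r))
  refine h1.trans ?_
  exact congrArg (X.residue w) (Scheme.Hom.stalkSpecializes_stalkMap_apply i w x h r)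

/-- The local ring of the closure is the same computed in `P` or in `X`, so orders of vanishing
agree. -/
lemma IsOrd.residueFieldMap [SurjectiveOnStalks i] (h : w ⤳ x) (h' : i w ⤳ i x)
    {F : P.residueField (i w)} {n : ℤ} (hF : IsOrd h' F n) :
    IsOrd h (i.residueFieldMap w F) n := by
  obtain ⟨a, b, ha, hb, hab, rfl⟩ := hF
  let π : LocalRingAt h' ≃+* LocalRingAt h := .ofBijective
    (Ideal.quotientMap (primeOf h) (i.stalkMap x).hom (comap_stalkMap_primeOf i h h').ge)
    ⟨Ideal.quotientMap_injective' (comap_stalkMap_primeOf i h h').le,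
      Ideal.quotientMap_surjective (i.stalkMap_surjective x)⟩
  refine ⟨π a, π b, (map_ne_zero_iff π π.injective).2 ha, (map_ne_zero_iff π π.injective).2 hb,
    ?_, by rw [ord_comap π, ord_comap π]⟩
  have := congrArg (i.residueFieldMap w) hab
  rw [map_mul, residueFieldMap_toResidueField i h h', residueFieldMap_toResidueField i h h'] at this
  exact this

end

lemma IsOrd.of_mul_eq {w x : X} (h : w ⤳ x) {F F' : X.residueField w} {n : ℤ} (hF : IsOrd h F n)
    {c : LocalRingAt h} (hc : IsUnit c) (hF' : F' * toResidueField h c = F) : IsOrd h F' n := by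
  obtain ⟨a, b, ha, hb, hab, rfl⟩ := hF
  refine ⟨a, c * b, ha, mul_ne_zero hc.ne_zero hb, ?_, ?_⟩
  · rw [map_mul, ← mul_assoc, hF', hab]
  · rw [Ring.ord, Ring.ord, Ring.ord, Ideal.span_singleton_mul_left_unit hc]

/-- If `g = c (t - q)` at the generic point, the section `g⁻¹` is `c⁻¹` times the global generator
`(t - q)⁻¹`. Its divisor is therefore that of the residue of `c⁻¹`, a function on a subset of
codimension `p - 1` in `X`. -/
lemma IsDivOfNormalBundle.mem_principalCycles [IsNoetherian X] {p q : ℤ} {v : Box X}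
    (hv : v ∈ pointsOfCodim (Box X) p) {z : Cycles X p (preClosure (iota X q) v)}
    (hz : IsDivOfNormalBundle (iota X q) p v z) :
    z ∈ principalCycles X p (preClosure (iota X q) v) := by
  obtain ⟨w, rfl, g, hg, hz⟩ := hz
  set e := fun y : Box X => (Box X).presheaf.germ ⊤ y trivial (Box.t X - (q : Γ(Box X, ⊤)))
    with he
  have hNZD (y) : e y ∈ nonZeroDivisors _ := germ_t_sub_mem_nonZeroDivisors q y
  obtain ⟨c, hc, rfl⟩ := exists_isUnit_mul_eq_of_span_eq (hNZD _) (hg.trans (ker_stalkMap_iota q w))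
  have hr := (hc.map ((Box X).residue (iota X q w)).hom)
  have hf := (hr.inv.map ((iota X q).residueFieldMap w).hom)
  refine AddSubgroup.subset_closure ⟨w, mem_pointsOfCodim_of_iota hv, subset_closure rfl,
    hf.unit, fun x => ⟨fun h => ?_, fun h => absurd ?_ h⟩⟩
  · obtain ⟨h', g', u, hg', hu, hord⟩ := hz x
    obtain ⟨c', hc', rfl⟩ :=
      exists_isUnit_mul_eq_of_span_eq (hNZD _) (hg'.trans (ker_stalkMap_iota q x.1))
    refine IsOrd.residueFieldMap (iota X q) h h' ?_
    -- At `x` the relation `g' = u g` reads `c' = u c`, so `u` and `c⁻¹` differ by the unit `c'` and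
    -- have the same order.
    refine hord.of_mul_eq h' (c := Ideal.Quotient.mk _ c') (hc'.map _) ?_
    have h1 : (Box X).presheaf.stalkSpecializes h' (e (iota X q x.1)) = e (iota X q w) :=
      TopCat.Presheaf.germ_stalkSpecializes_apply _ _ _ _
    rw [map_mul, h1, ← mul_assoc, mul_cancel_right_mem_nonZeroDivisors (hNZD _)] at hu
    have h2 : toResidueField h' (Ideal.Quotient.mk _ c') =
        (Box X).residue (iota X q w) ((Box X).presheaf.stalkSpecializes h' c') := rfl
    rw [h2, hu, map_mul, mul_comm]
    exact mul_inv_cancel_right₀ (b := (Box X).residue (iota X q w) c) hr.ne_zero _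
  · obtain ⟨h', -⟩ := hz x
    have := h'.map (Box.proj X).continuous
    rwa [proj_iota, proj_iota] at this

lemma pullbackClass_iota_eq_zero [IsNoetherian X] {p q : ℤ} {v : Box X}
    (hv : v ∈ pointsOfCodim (Box X) p) (hvq : v ∈ Set.range (iota X q)) :
    pullbackClass (iota X q) p v = 0 := by
  rw [pullbackClass, if_pos hvq]
  split_ifs with h
  · exact (QuotientAddGroup.eq_zero_iff _).2 (h.choose_spec.mem_principalCycles hv)
  -- Without a divisor of a rational section the class is `0` by convention.
  · rfl

lemma intersectionCycle_eq_zero_of_isEmpty {Y P : Scheme.{u}} [IsNoetherian Y] (i : Y ⟶ P) (p : ℤ)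
    {v : P} (h : (preClosure i v : Set Y) = ∅) : intersectionCycle i p v = 0 := by
  ext x
  have hx : x.1 ∈ (∅ : Set Y) := h.subset x.2.2
  exact absurd hx (Set.notMem_empty _)

/-- The fibre over `t = q` of a closed subset of the fibre over `t = q'` is empty when `q - q'` is
a unit. -/
lemma preClosure_iota_iota (q q' : ℤ) (hqq : IsUnit (q - q')) (w : X) :
    (preClosure (iota X q) (iota X q' w) : Set X) = ∅ := by
  refine Set.eq_empty_iff_forall_notMem.2 fun x hx => ?_
  have hx : iota X q' w ⤳ iota X q x := specializes_iff_mem_closure.2 hx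
  have h1 : iota X q' w ∈ Set.range (iota X q') := ⟨w, rfl⟩
  have h2 := hx.mem_closed (iota X q').isClosedEmbedding.isClosed_range h1
  obtain ⟨y, hy⟩ := h2
  have h3 := congrArg (Box.proj X) hy
  rw [proj_iota, proj_iota] at h3
  subst h3
  rw [iota_apply, iota_apply] at hy
  have h4 := graphPoint_injective _ hy
  have h5 := (hqq.map (Int.castRingHom (X.residueField y))).ne_zero
  rw [map_sub] at h5
  exact h5 (sub_eq_zero.2 h4.symm)

end ChowMod

/-! ### The map `ε` and exactness -/

namespace ChowMod

noncomputable section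

variable {X : Scheme.{u}}

lemma Cycles.incl_injective (p : ℤ) {S S' : Set X} (h : S ⊆ S') :
    Function.Injective (Cycles.incl (X := X) p h) :=
  Finsupp.mapDomain_injective fun _ _ hab => Subtype.ext (Subtype.mk.inj hab)

/-- The value `f = 1` needs separate treatment, since the coordinate `f / (f - 1)` of the graph is
then infinite. -/
lemma IsDiv.eq_zero_of_one {p : ℤ} {S : Set X} {w : X} {z : Cycles X p S}
    (hz : IsDiv w 1 z) : z = 0 := by
  ext x
  by_cases h : w ⤳ x.1
  · obtain ⟨a, b, -, -, hab, hx⟩ := (hz x).1 h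
    rw [Units.val_one, one_mul] at hab
    rw [hx, toResidueField_injective h hab, sub_self]
    rfl
  · exact (hz x).2 h

variable {D : X.IdealSheafData} {p : ℤ}

instance : SemilatticeSup (Supports D) :=
  Subtype.semilatticeSup fun _ _ h h' => Set.disjoint_union_left.2 ⟨h, h'⟩

instance : Nonempty (Supports D) := ⟨⊥, Set.empty_disjoint _⟩

lemma Supports.coe_subset {Y Y' : Supports D} (h : Y ≤ Y') : (Y.1 : Set X) ⊆ Y'.1 := h

lemma ColimChow.exists_of_mk (c : ColimChow D p) :
    ∃ (Y : Supports D) (z : Cycles X p (Y.1 : Set X)), ColimChow.of D p Y (Chow.mk z) = c := by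
  classical
  induction c using AddCommGroup.DirectLimit.induction_on with
  | ih Y c =>
    obtain ⟨z, rfl⟩ := QuotientAddGroup.mk'_surjective _ c
    exact ⟨Y, z, rfl⟩

lemma ColimChow.of_mk_incl {Y Y' : Supports D} (h : Y ≤ Y') (z : Cycles X p (Y.1 : Set X)) :
    ColimChow.of D p Y' (Chow.mk (Cycles.incl p (Supports.coe_subset h) z)) = ColimChow.of D p Y (Chow.mk z) := by
  classical
  exact AddCommGroup.DirectLimit.of_f (f := fun (Y Y' : Supports D) h => Chow.map p h) h (Chow.mk z)

/-- Supports are closed under union, and the two cycles already agree on `Y ⊔ Y'`. -/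
lemma ColimChow.of_mk_eq_of_incl_eq {Y Y' : Supports D} {z : Cycles X p (Y.1 : Set X)}
    {z' : Cycles X p (Y'.1 : Set X)}
    (h : Cycles.incl p Y.subset_pointsOff z = Cycles.incl p Y'.subset_pointsOff z') :
    ColimChow.of D p Y (Chow.mk z) = ColimChow.of D p Y' (Chow.mk z') := by
  rw [← ColimChow.of_mk_incl (le_sup_left : Y ≤ Y ⊔ Y'),
    ← ColimChow.of_mk_incl (le_sup_right : Y' ≤ Y ⊔ Y')]
  congr 2
  refine Cycles.incl_injective p (Y ⊔ Y').subset_pointsOff ?_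
  rwa [Cycles.incl_incl, Cycles.incl_incl]

variable [IsNoetherian X]

lemma modulusPullback_single (q : ℤ) (w) (n : ℤ) : modulusPullback D p q (Finsupp.single w n) =
    n • Cycles.incl p (preClosure_subset_pointsOff q w.2.2.2.2)
      (intersectionCycle (iota X q) p w.1) := by
  simp [modulusPullback]

lemma ChowWithModulus.mk_eq_zero {z : ModulusCycles D p}
    (β : ModulusCycles₁ D p) (h : z = modulusPullback D p 0 β - modulusPullback D p 1 β) :
    ChowWithModulus.mk D p z = 0 :=
  (QuotientAddGroup.eq_zero_iff _).2 ⟨β, h.symm⟩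

/-- The graph of `f / (f - 1)` is a generator of `Z^p(X|D, 1)` with boundary `div f`: it lies over
`Y`, which misses `D`, and its generic value is neither `0` nor `1`. -/
lemma mk_incl_eq_zero_of_isDiv (Y : Supports D) {w : X} (hw : w ∈ pointsOfCodim X (p - 1))
    (hwY : w ∈ Y.1) {f : (X.residueField w)ˣ} {z : Cycles X p (Y.1 : Set X)} (hz : IsDiv w f z) :
    ChowWithModulus.mk D p (Cycles.incl p Y.subset_pointsOff z) = 0 := by
  by_cases hf : (f : X.residueField w) = 1
  · obtain rfl : f = 1 := Units.ext hf
    rw [hz.eq_zero_of_one, map_zero, map_zero]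
  have hf' : (f : X.residueField w) - 1 ≠ 0 := sub_ne_zero.2 hf
  set g : X.residueField w := f / (f - 1) with hg
  have hgf : g * (f - 1) = f := div_mul_cancel₀ _ hf'
  have h0 : g ≠ (0 : ℤ) := by
    rw [Int.cast_zero]
    exact div_ne_zero f.ne_zero hf'
  have h1 : g ≠ (1 : ℤ) := by
    rw [Int.cast_one]
    intro h
    rw [h, one_mul, sub_eq_self] at hgf
    exact one_ne_zero hgf
  have hmod : graphPoint w g ∈ modulusPoints D :=
    ⟨graphPoint_notMem_range_iota h0, graphPoint_notMem_range_iota h1,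
      satisfiesModulus_closure_singleton (by
        rw [proj_graphPoint]
        exact Y.subset_pointsOff hwY)⟩
  refine ChowWithModulus.mk_eq_zero (Finsupp.single
    ⟨graphPoint w g, graphPoint_mem_pointsOfCodim hw g, hmod⟩ 1) ?_
  rw [modulusPullback_single, modulusPullback_single, one_smul, one_smul]
  exact isDiv_apply_eq_sub hw hf hz _
    (closure_minimal (Set.singleton_subset_iff.2 hwY) Y.1.isClosed) _ _

/-- The map `CH^p_Y(X) → CH^p(X|D)` for a closed subset `Y` not meeting `D`. -/
def Chow.toModulus (Y : Supports D) : Chow X p Y.1 →+ ChowWithModulus D p :=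
  QuotientAddGroup.lift (principalCycles X p Y.1)
    ((ChowWithModulus.mk D p).comp (Cycles.incl p Y.subset_pointsOff)) <| by
      rw [principalCycles, AddSubgroup.closure_le]
      rintro z ⟨w, hw, hwY, f, hz⟩
      exact mk_incl_eq_zero_of_isDiv Y hw hwY hz

variable (D p) in
open Classical in
/-- The map `ε : colim CH^p_Y(X) → CH^p(X|D)`. -/
def ColimChow.toModulus : ColimChow D p →+ ChowWithModulus D p :=
  AddCommGroup.DirectLimit.lift _ _ _ (fun Y => Chow.toModulus Y) fun Y Y' h z => by
    obtain ⟨z, rfl⟩ := QuotientAddGroup.mk'_surjective _ z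
    exact congrArg (ChowWithModulus.mk D p) (Cycles.incl_incl p _ _ z)

lemma ColimChow.toModulus_of (Y : Supports D) (c : Chow X p Y.1) :
    ColimChow.toModulus D p (ColimChow.of D p Y c) = Chow.toModulus Y c := by
  classical
  exact AddCommGroup.DirectLimit.lift_of _ _ _ _ _

lemma ColimChow.toModulus_of_mk (Y : Supports D) (z : Cycles X p (Y.1 : Set X)) :
    ColimChow.toModulus D p (ColimChow.of D p Y (Chow.mk z)) =
      ChowWithModulus.mk D p (Cycles.incl p Y.subset_pointsOff z) :=
  ColimChow.toModulus_of Y _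

/-- The structure map `Z^p_Y(X × □¹) → colim Z^p_Y(X × □¹)`. -/
abbrev ColimCycles₁.of (D : X.IdealSheafData) (p : ℤ) (Y : Supports₁ D) :
    Cycles (Box X) p (Y.1 : Set (Box X)) →+ ColimCycles₁ D p := by
  classical
  exact AddCommGroup.DirectLimit.of (fun Y : Supports₁ D => Cycles (Box X) p (Y.1 : Set (Box X)))
    (fun _ _ h => Cycles.incl p h) Y

lemma pullbackHom_single {P : Scheme.{u}} (i : X ⟶ P) (Y : Closeds P) (v) (n : ℤ) :
    pullbackHom i p Y (Finsupp.single v n) =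
      n • Chow.map p (preClosure_le i v.2.2) (pullbackClass i p v.1) := by
  simp [pullbackHom]

/-- Triviality of the normal bundle settles `q = q'`. A unit difference keeps `q` and `q'` distinct
in every residue field, which leaves the other fibre empty. -/
lemma pullbackClass_eq_zero_of_mem_range {p q q' : ℤ} (hq : q = q' ∨ IsUnit (q - q')) {v : Box X}
    (hv : v ∈ pointsOfCodim (Box X) p) (hvq : v ∈ Set.range (iota X q')) :
    pullbackClass (iota X q) p v = 0 := by
  obtain rfl | hq := hq
  · exact pullbackClass_iota_eq_zero hv hvq
  by_cases hvq' : v ∈ Set.range (iota X q)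
  · exact pullbackClass_iota_eq_zero hv hvq'
  · obtain ⟨w, rfl⟩ := hvq
    rw [pullbackClass, if_neg hvq',
      intersectionCycle_eq_zero_of_isEmpty _ _ (preClosure_iota_iota q q' hq w), map_zero]

/-- The structure map `CH^p_{ι_q⁻¹(Y)}(X) → colim CH^p_Y(X)`. -/
def Supports₁.ofFibre (q : ℤ) (Y : Supports₁ D) :
    Chow X p (Y.1.preimage (iota X q).continuous) →+ ColimChow D p :=
  ColimChow.of D p (Y.fibre q)

lemma Supports₁.ofFibre_map_mk (q : ℤ) (Y : Supports₁ D) {V : Closeds X}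
    (h : V ≤ Y.1.preimage (iota X q).continuous) (h' : (V : Set X) ⊆ (Y.fibre q).1)
    (z : Cycles X p (V : Set X)) : Y.ofFibre q (Chow.map p h (Chow.mk z)) =
      ColimChow.of D p (Y.fibre q) (Chow.mk (Cycles.incl p h' z)) :=
  rfl

lemma colimPullback_of_single (q : ℤ) (Y : Supports₁ D) (v) (n : ℤ) :
    colimPullback D p q (ColimCycles₁.of D p Y (Finsupp.single v n)) =
      n • Y.ofFibre q
        (Chow.map p (preClosure_le (iota X q) v.2.2) (pullbackClass (iota X q) p v.1)) := by
  classical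
  refine (AddCommGroup.DirectLimit.lift_of _ _ _ _ _).trans ?_
  exact (congrArg (Y.ofFibre q) (pullbackHom_single (iota X q) Y.1 v n)).trans 
    (map_zsmul (Y.ofFibre q) n _)

lemma preClosure_subset_fibre (q : ℤ) (Y : Supports₁ D) {v : Box X}
    (hv : v ∈ (Y.1 : Set (Box X))) : (preClosure (iota X q) v : Set X) ⊆ (Y.fibre q).1 :=
  preClosure_le (iota X q) hv

lemma colimPullback_of_single_of_notMem_range {q : ℤ} {Y : Supports₁ D} {v : Box X}
    (hv : v ∈ pointsOfCodim (Box X) p) (hvY : v ∈ (Y.1 : Set (Box X)))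
    (hvq : v ∉ Set.range (iota X q)) (n : ℤ) :
    colimPullback D p q (ColimCycles₁.of D p Y (Finsupp.single ⟨v, hv, hvY⟩ n)) =
      ColimChow.of D p (Y.fibre q) (Chow.mk
        (n • Cycles.incl p (preClosure_subset_fibre q Y hvY)
          (intersectionCycle (iota X q) p v))) := by
  rw [colimPullback_of_single, pullbackClass, if_neg hvq,
    Supports₁.ofFibre_map_mk q Y _ (preClosure_subset_fibre q Y hvY)]
  exact (map_zsmul ((ColimChow.of D p (Y.fibre q)).comp Chow.mk) n _).symm

lemma colimPullback_of_single_of_mem_range {q q' : ℤ} (hq : q = q' ∨ IsUnit (q - q'))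
    {Y : Supports₁ D} {v : Box X}
    (hv : v ∈ pointsOfCodim (Box X) p) (hvY : v ∈ (Y.1 : Set (Box X)))
    (hvq : v ∈ Set.range (iota X q')) (n : ℤ) :
    colimPullback D p q (ColimCycles₁.of D p Y (Finsupp.single ⟨v, hv, hvY⟩ n)) = 0 := by
  rw [colimPullback_of_single, pullbackClass_eq_zero_of_mem_range hq hv hvq, map_zero, map_zero,
    smul_zero]

lemma toModulus_colimPullback (hD : IsEffectiveCartier D) (x : ColimCycles₁ D p) :
    ColimChow.toModulus D p ((colimPullback D p 0 - colimPullback D p 1) x) = 0 := by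
  classical
  suffices h : (ColimChow.toModulus D p).comp (colimPullback D p 0 - colimPullback D p 1) = 0 from
    DFunLike.congr_fun h x
  refine AddCommGroup.DirectLimit.hom_ext (P := ChowWithModulus D p) fun Y =>
    Finsupp.addHom_ext fun ⟨v, hv, hvY⟩ n => ?_
  change ColimChow.toModulus D p
    (colimPullback D p 0 (ColimCycles₁.of D p Y (Finsupp.single ⟨v, hv, hvY⟩ n)) -
      colimPullback D p 1 (ColimCycles₁.of D p Y (Finsupp.single ⟨v, hv, hvY⟩ n))) = 0
  by_cases h0 : v ∈ Set.range (iota X 0)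
  · rw [colimPullback_of_single_of_mem_range (.inl rfl) hv hvY h0,
      colimPullback_of_single_of_mem_range (.inr (by norm_num)) hv hvY h0, sub_zero, map_zero]
  by_cases h1 : v ∈ Set.range (iota X 1)
  · rw [colimPullback_of_single_of_mem_range (.inr (by norm_num)) hv hvY h1,
      colimPullback_of_single_of_mem_range (.inl rfl) hv hvY h1, sub_zero, map_zero]
  -- Only `Y` is known to satisfy the modulus condition; the closure of `v` inherits it, so `v`
  -- defines a relation in the Chow group with modulus.
  have hmod : v ∈ modulusPoints D := ⟨h0, h1, Y.2.closure_singleton hD Y.1.isClosed hvY⟩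
  rw [colimPullback_of_single_of_notMem_range hv hvY h0,
    colimPullback_of_single_of_notMem_range hv hvY h1, map_sub,
    ColimChow.toModulus_of_mk, ColimChow.toModulus_of_mk, ← map_sub, map_zsmul, map_zsmul,
    Cycles.incl_incl, Cycles.incl_incl]
  refine ChowWithModulus.mk_eq_zero (Finsupp.single ⟨v, hv, hmod⟩ n) ?_
  rw [modulusPullback_single, modulusPullback_single]

/-- Every cycle satisfying the modulus condition lifts to `colim Z^p_Y(X × □¹)`. -/
lemma exists_colimPullback_eq (β : ModulusCycles₁ D p) :
    ∃ (x : ColimCycles₁ D p) (Y : Supports D) (z : Cycles X p (Y.1 : Set X)),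
      (colimPullback D p 0 - colimPullback D p 1) x = ColimChow.of D p Y (Chow.mk z) ∧
      Cycles.incl p Y.subset_pointsOff z = (modulusPullback D p 0 - modulusPullback D p 1) β := by
  induction β using Finsupp.induction_linear with
  | zero => exact ⟨0, Classical.arbitrary _, 0, by simp, by simp⟩
  | add β β' h h' =>
    obtain ⟨x, Y, z, hx, hz⟩ := h
    obtain ⟨x', Y', z', hx', hz'⟩ := h'
    have h : Y ≤ Y ⊔ Y' := le_sup_left
    have h' : Y' ≤ Y ⊔ Y' := le_sup_right
    refine ⟨x + x', Y ⊔ Y', Cycles.incl p (Supports.coe_subset h) z +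
      Cycles.incl p (Supports.coe_subset h') z', ?_, ?_⟩
    · rw [map_add, map_add, map_add, hx, hx', ColimChow.of_mk_incl h, ColimChow.of_mk_incl h']
    · rw [map_add, map_add, ← hz, ← hz', Cycles.incl_incl, Cycles.incl_incl]
  | single v n =>
    -- The smallest support containing `v` is enough. Its two fibres are different supports in `X`,
    -- and their cycles are compared on the union.
    let V : Supports₁ D := ⟨Closeds.closure {v.1}, v.2.2.2.2⟩
    have hV : v.1 ∈ V.1 := subset_closure rfl
    let Y := V.fibre 0 ⊔ V.fibre 1
    have h0 : V.fibre 0 ≤ Y := le_sup_left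
    have h1 : V.fibre 1 ≤ Y := le_sup_right
    have hs (q : ℤ) := preClosure_subset_fibre q V hV
    refine ⟨ColimCycles₁.of D p V (Finsupp.single ⟨v, v.2.1, hV⟩ n), Y,
      Cycles.incl p (Supports.coe_subset h0)
          (n • Cycles.incl p (hs 0) (intersectionCycle (iota X 0) p v.1)) -
        Cycles.incl p (Supports.coe_subset h1)
          (n • Cycles.incl p (hs 1) (intersectionCycle (iota X 1) p v.1)), ?_, ?_⟩
    · rw [AddMonoidHom.sub_apply, colimPullback_of_single_of_notMem_range v.2.1 hV v.2.2.1,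
        colimPullback_of_single_of_notMem_range v.2.1 hV v.2.2.2.1, map_sub, map_sub,
        ColimChow.of_mk_incl h0, ColimChow.of_mk_incl h1]
    · rw [AddMonoidHom.sub_apply, modulusPullback_single, modulusPullback_single, map_sub,
        Cycles.incl_incl, Cycles.incl_incl, map_zsmul, map_zsmul, Cycles.incl_incl,
        Cycles.incl_incl]

lemma ColimChow.toModulus_surjective : Function.Surjective (ColimChow.toModulus D p) := by
  intro c
  obtain ⟨z, rfl⟩ := QuotientAddGroup.mk'_surjective _ c
  induction z using Finsupp.induction_linear with
  | zero => exact ⟨0, by simp⟩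
  | add z z' h h' =>
    obtain ⟨x, hx⟩ := h
    obtain ⟨x', hx'⟩ := h'
    exact ⟨x + x', by rw [map_add, map_add, hx, hx']⟩
  | single v n =>
    let Y : Supports D := ⟨Closeds.closure {v.1}, v.2.2⟩
    refine ⟨ColimChow.of D p Y (Chow.mk (Finsupp.single ⟨v.1, v.2.1, subset_closure rfl⟩ n)), ?_⟩
    rw [ColimChow.toModulus_of_mk, Cycles.incl_single]
    rfl

end

end ChowMod

theorem proposition2p10 {X : Scheme.{u}} [IsNoetherian X] [X.IsSeparated]
    (hX : ChowMod.IsUnicodimensional X) (hX' : ChowMod.IsCatenary X)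
    (D : X.IdealSheafData) (hD : ChowMod.IsEffectiveCartier D) (p : ℤ) :
    ∃ ε : ChowMod.ColimChow D p →+ ChowMod.ChowWithModulus D p,
      (∀ (Y : ChowMod.Supports D) (z : ChowMod.Cycles X p (Y.1 : Set X)),
        ε (ChowMod.ColimChow.of D p Y (ChowMod.Chow.mk z)) =
          ChowMod.ChowWithModulus.mk D p (ChowMod.Cycles.incl p Y.subset_pointsOff z)) ∧
      Function.Exact (ChowMod.colimPullback D p 0 - ChowMod.colimPullback D p 1) ε ∧
      Function.Surjective ε := by
  refine ⟨ChowMod.ColimChow.toModulus D p, ChowMod.ColimChow.toModulus_of_mk, fun c => ⟨?_, ?_⟩,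
    ChowMod.ColimChow.toModulus_surjective⟩
  · intro hc
    obtain ⟨Y, z, rfl⟩ := ChowMod.ColimChow.exists_of_mk c
    rw [ChowMod.ColimChow.toModulus_of_mk] at hc
    obtain ⟨β, hβ⟩ := (QuotientAddGroup.eq_zero_iff _).1 hc
    -- The relation killing `z` is lifted to the colimit; its boundary equals `z` as a cycle,
    -- although it may be supported on another `Y'`.
    obtain ⟨x, Y', z', hx, hz'⟩ := ChowMod.exists_colimPullback_eq β
    exact ⟨x, hx.trans (ChowMod.ColimChow.of_mk_eq_of_incl_eq (hz'.trans hβ))⟩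
  · rintro ⟨x, rfl⟩
    exact ChowMod.toModulus_colimPullback hD x
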